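/- Let $\alpha,\beta\in(1,2)$, $a_1<b_1$, $a_2<b_2$, $T>0$, and consider the two-dimensional space-fractional diffusion equation $$\partial_t u=d_+\frac{\partial^\alpha u}{\partial_+x^\alpha}+d_-\frac{\partial^\alpha u}{\partial_-x^\alpha}+e_+\frac{\partial^\beta u}{\partial_+y^\beta}+e_-\frac{\partial^\beta u}{\partial_-y^\beta}+v\quad\text{on }(a_1,b_1)\times(a_2,b_2)\times(0,T]$$ with zero boundary values and constant, equal diffusion coefficients $d_\pm\equiv d>0$, $e_\pm\equiv e>0$. For $\gamma\in(1,2)$ put $g_k^{(\gamma)}=(-1)^k\binom{\gamma}{k}$, $w_0^{(\gamma)}=\frac{\gamma}{2}g_0^{(\gamma)}$, $w_k^{(\gamma)}=\frac{\gamma}{2}g_k^{(\gamma)}+\frac{2-\gamma}{2}g_{k-1}^{(\gamma)}$ for $k\ge 1$, $w_k^{(\gamma)}=0$ for $k<0$, and $A^\gamma_n=[-w^{(\gamma)}_{i-j+1}]_{i,j=1}^n$. For positive integers $n_1,n_2,M$ put $N=n_1n_2$, $h_x=\frac{b_1-a_1}{n_1+1}$, $h_y=\frac{b_2-a_2}{n_2+1}$,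 $\Delta t=\frac TM$, $r=\frac{\Delta t}{2h_x^\alpha}$, $s=\frac{\Delta t}{2h_y^\beta}$. The coefficient matrix of the Crank–Nicolson weighted and shifted Grünwald scheme at time step $m\in\{1,\dots,M\}$, multiplied by $1/r$, is $$\mathcal M_N^{(m)}=\tfrac1r I_N+A_x^{(m)}+\tfrac sr A_y^{(m)},$$ $$A_x^{(m)}=D_+(I_{n_2}\otimes A^\alpha_{n_1})+D_-(I_{n_2}\otimes (A^\alpha_{n_1})^T),\qquad A_y^{(m)}=E_+(A^\beta_{n_2}\otimes I_{n_1})+E_-((A^\beta_{n_2})^T\otimes I_{n_1}),$$ where $D_\pm,E_\pm$ are the diagonal matrices of the samples of $d_\pm,e_\pm$ at the interior grid points $(a_1+ih_x,a_2+jh_y)$ and at time $m\Delta t$. Consider any sequence of discretizations $(n_1,n_2,M,m)$ with $N=n_1n_2\to\infty$, $\frac1r=o(1)$ and $\frac sr=\frac{h_x^\alpha}{h_y^\beta}=O(1)$. Let $$f_\gamma(\xi)=-\sum_{k=-1}^\infty w^{(\gamma)}_{k+1}e^{\mathrm ik\xi},\qquad q_\gamma(\xi)=f_\gamma(\xi)+f_\gamma(-\xi),$$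 $$\mathcal F_{(\alpha,\beta)}(\theta_1,\theta_2)=d\,q_\alpha(\theta_1)+e\,\tfrac sr\,q_\beta(\theta_2).$$ Then: 1. The series defining $f_\alpha$ and $f_\beta$ converge absolutely, and $f_\gamma(-\xi)=\overline{f_\gamma(\xi)}$ for $\gamma\in\{\alpha,\beta\}$ and $\xi\in\mathbb R$. 2. $\mathcal F_{(\alpha,\beta)}$ is real-valued, continuous and nonnegative; the same holds with $s/r$ replaced by any constant $c\ge0$. 3. $\{\mathcal M_N^{(m)}\}$ is distributed as $(\mathcal F_{(\alpha,\beta)},[-\pi,\pi]^2)$ in the sense of the eigenvalues: for every continuous compactly supported $F:\mathbb C\to\mathbb C$, with the eigenvalues $\lambda_j$ counted with multiplicity, $$\frac1N\sum_{j=1}^N F\big(\lambda_j(\mathcal M_N^{(m)})\big)-\frac1{4\pi^2}\int_{[-\pi,\pi]^2}F\big(\mathcal F_{(\alpha,\beta)}(\theta)\big)\,d\theta\longrightarrow0,$$ where $\mathcal F_{(\alpha,\beta)}$ contains the ratio $s/r$ of the respective discretization. If moreover $s/r\to c$ along the sequence, then $$\frac1N\sum_{j=1}^N F\big(\lambda_j(\mathcal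 M_N^{(m)})\big)\longrightarrow\frac1{4\pi^2}\int_{[-\pi,\pi]^2}F\big(d\,q_\alpha(\theta_1)+e\,c\,q_\beta(\theta_2)\big)\,d\theta.$$ -/

import Mathlib

open Filter Topology MeasureTheory Set Asymptotics
open scoped Kronecker

noncomputable section

/-- The data of the two-dimensional space-fractional diffusion problem
`u_t = d₊ ∂^α u/∂₊x^α + d₋ ∂^α u/∂₋x^α + e₊ ∂^β u/∂₊y^β + e₋ ∂^β u/∂₋y^β + v`
on `(a₁,b₁) × (a₂,b₂) × (0,T]` which enter the coefficient matrices of its discretization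
(the forcing term and the initial datum only enter the right-hand sides). -/
structure FDEData where
  /-- order of the fractional derivatives in `x` -/
  α : ℝ
  /-- order of the fractional derivatives in `y` -/
  β : ℝ
  a₁ : ℝ
  b₁ : ℝ
  a₂ : ℝ
  b₂ : ℝ
  /-- final time -/
  T : ℝ
  dPlus : ℝ → ℝ → ℝ → ℝ
  dMinus : ℝ → ℝ → ℝ → ℝ
  ePlus : ℝ → ℝ → ℝ → ℝ
  eMinus : ℝ → ℝ → ℝ → ℝ
  hα : α ∈ Ioo (1 : ℝ) 2
  hβ : β ∈ Ioo (1 : ℝ) 2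
  hab₁ : a₁ < b₁
  hab₂ : a₂ < b₂
  hT : 0 < T
  /-- the diffusion coefficients are nonnegative -/
  hnonneg : ∀ x ∈ Ioo a₁ b₁, ∀ y ∈ Ioo a₂ b₂, ∀ t ∈ Ioc 0 T,
    0 ≤ dPlus x y t ∧ 0 ≤ dMinus x y t ∧ 0 ≤ ePlus x y t ∧ 0 ≤ eMinus x y t

/-- Alternating fractional binomial coefficients
`g_k = (-1)^k γ (γ - 1) ⋯ (γ - k + 1) / k!`. -/
def gCoeff (γ : ℝ) (k : ℕ) : ℝ :=
  (-1) ^ k / (k.factorial : ℝ) * ∏ i ∈ Finset.range k, (γ - (i : ℝ))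

/-- Weights of the weighted and shifted Grünwald difference formula with shifts `(1, 0)`. -/
def wCoeff (γ : ℝ) : ℕ → ℝ
  | 0 => γ / 2 * gCoeff γ 0
  | k + 1 => γ / 2 * gCoeff γ (k + 1) + (2 - γ) / 2 * gCoeff γ k

/-- The lower Hessenberg Toeplitz matrix `[-w_{i-j+1}]`, where `w_k = 0` for `k < 0`. -/
def toepA (γ : ℝ) (n : ℕ) : Matrix (Fin n) (Fin n) ℝ :=
  Matrix.of fun i j =>
    if (j : ℕ) ≤ (i : ℕ) + 1 then -wCoeff γ ((i : ℕ) + 1 - (j : ℕ)) else 0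

namespace FDEData

/-- Mesh size in `x` with `n₁` interior nodes. -/
def hx (P : FDEData) (n₁ : ℕ) : ℝ := (P.b₁ - P.a₁) / ((n₁ : ℝ) + 1)

/-- Mesh size in `y` with `n₂` interior nodes. -/
def hy (P : FDEData) (n₂ : ℕ) : ℝ := (P.b₂ - P.a₂) / ((n₂ : ℝ) + 1)

/-- Time step with `M` steps. -/
def dt (P : FDEData) (M : ℕ) : ℝ := P.T / (M : ℝ)

/-- `r = Δt / (2 h_x^α)`. -/
def r (P : FDEData) (n₁ M : ℕ) : ℝ := P.dt M / (2 * P.hx n₁ ^ P.α)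

/-- `s = Δt / (2 h_y^β)`. -/
def s (P : FDEData) (n₂ M : ℕ) : ℝ := P.dt M / (2 * P.hy n₂ ^ P.β)

/-- The diagonal matrix of the samples `c(x_i, y_j, t^{(m)})` of a coefficient `c` at the interior
nodes. The unknowns are ordered with the `x`-index running fastest, so the index is `(j, i)`;
`Fin` starts at `0`, hence the shift by one. -/
def diagSample (P : FDEData) (c : ℝ → ℝ → ℝ → ℝ) (n₁ n₂ M m : ℕ) :
    Matrix (Fin n₂ × Fin n₁) (Fin n₂ × Fin n₁) ℝ :=
  Matrix.diagonal fun p =>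
    c (P.a₁ + (((p.2 : ℕ) : ℝ) + 1) * P.hx n₁)
      (P.a₂ + (((p.1 : ℕ) : ℝ) + 1) * P.hy n₂)
      ((m : ℝ) * P.dt M)

/-- `A_x^{(m)} = D₊ (I ⊗ A^α) + D₋ (I ⊗ (A^α)ᵀ)`. -/
def matAx (P : FDEData) (n₁ n₂ M m : ℕ) :
    Matrix (Fin n₂ × Fin n₁) (Fin n₂ × Fin n₁) ℝ :=
  P.diagSample P.dPlus n₁ n₂ M m * ((1 : Matrix (Fin n₂) (Fin n₂) ℝ) ⊗ₖ toepA P.α n₁)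
    + P.diagSample P.dMinus n₁ n₂ M m
        * ((1 : Matrix (Fin n₂) (Fin n₂) ℝ) ⊗ₖ (toepA P.α n₁).transpose)

/-- `A_y^{(m)} = E₊ (A^β ⊗ I) + E₋ ((A^β)ᵀ ⊗ I)`. -/
def matAy (P : FDEData) (n₁ n₂ M m : ℕ) :
    Matrix (Fin n₂ × Fin n₁) (Fin n₂ × Fin n₁) ℝ :=
  P.diagSample P.ePlus n₁ n₂ M m * (toepA P.β n₂ ⊗ₖ (1 : Matrix (Fin n₁) (Fin n₁) ℝ))
    + P.diagSample P.eMinus n₁ n₂ M m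
        * ((toepA P.β n₂).transpose ⊗ₖ (1 : Matrix (Fin n₁) (Fin n₁) ℝ))

/-- The scaled coefficient matrix `(1/r) I + A_x^{(m)} + (s/r) A_y^{(m)}` of the linear system
solved at the `m`-th time step of the Crank–Nicolson scheme. -/
def coeffMatrix (P : FDEData) (n₁ n₂ M m : ℕ) :
    Matrix (Fin n₂ × Fin n₁) (Fin n₂ × Fin n₁) ℝ :=
  (1 / P.r n₁ M) • (1 : Matrix (Fin n₂ × Fin n₁) (Fin n₂ × Fin n₁) ℝ)
    + P.matAx n₁ n₂ M m + (P.s n₂ M / P.r n₁ M) • P.matAy n₁ n₂ M m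

end FDEData

/-- `f_γ(ξ) = -∑_{k ≥ -1} w_{k+1} e^{i k ξ}` (the summation index is shifted by one). -/
def fSymbol (γ ξ : ℝ) : ℂ :=
  -∑' k : ℕ, (wCoeff γ k : ℂ) * Complex.exp (Complex.I * ((k : ℂ) - 1) * (ξ : ℂ))

/-- `q_γ(ξ) = f_γ(ξ) + f_γ(-ξ)`. -/
def qSymbol (γ ξ : ℝ) : ℂ := fSymbol γ ξ + fSymbol γ (-ξ)

/-- `d q_α(θ₁) + e c q_β(θ₂)`; in the application `c` is the ratio `s / r`. -/
def symbolF (α β d e c : ℝ) (θ : ℝ × ℝ) : ℂ :=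
  (d : ℂ) * qSymbol α θ.1 + (e : ℂ) * (c : ℂ) * qSymbol β θ.2

/-- `(1/N) ∑_j F(λ_j(A))`, the eigenvalues being counted with algebraic multiplicity. -/
def eigMean {n : Type} [Fintype n] [DecidableEq n] (A : Matrix n n ℂ) (F : ℂ → ℂ) : ℂ :=
  (A.charpoly.roots.map F).sum / (Fintype.card n : ℂ)

/-- `(1/|G|) ∫_G F(f(t)) dt`. -/
def symbolMean {X : Type} [MeasureSpace X] (f : X → ℂ) (G : Set X) (F : ℂ → ℂ) : ℂ :=
  (((volume : Measure X).real G : ℝ) : ℂ)⁻¹ * ∫ t in G, F (f t)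

/-- The sequence of matrices `A k` is distributed as `(f, G)` in the sense of the eigenvalues. -/
def EigDistributed {n : ℕ → Type} [∀ k, Fintype (n k)] [∀ k, DecidableEq (n k)]
    (A : ∀ k, Matrix (n k) (n k) ℂ) {X : Type} [MeasureSpace X] (f : X → ℂ) (G : Set X) : Prop :=
  ∀ F : ℂ → ℂ, Continuous F → HasCompactSupport F →
    Tendsto (fun k => eigMean (A k) F) atTop (𝓝 (symbolMean f G F))

/-- The same for a symbol `f k` which varies along the sequence: for every test function the two
means are asymptotically equal. For `f k = f` this is `EigDistributed A f G`. -/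
def EigDistributedVarying {n : ℕ → Type} [∀ k, Fintype (n k)] [∀ k, DecidableEq (n k)]
    (A : ∀ k, Matrix (n k) (n k) ℂ) {X : Type} [MeasureSpace X] (f : ℕ → X → ℂ) (G : Set X) :
    Prop :=
  ∀ F : ℂ → ℂ, Continuous F → HasCompactSupport F →
    Tendsto (fun k => eigMean (A k) F - symbolMean (f k) G F) atTop (𝓝 0)

end

/-!
For constant coefficients the coefficient matrix is `1/r` times the identity, which moves all
eigenvalues by `o(1)` and does not affect their distribution, plus the Kronecker sum of the
Hermitian Toeplitz matrices with the symbols `d q_α` and `(s/r) e q_β`. The eigenvalues of the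
latter stay in a fixed interval, so by Weierstrass' theorem it suffices to compare moments. The
moments of the matrices are normalized traces of powers: for a Kronecker sum they are binomial sums
of products of the traces of powers of the two Toeplitz matrices. If `a` is absolutely summable, the
`p`-th power of `[a_{i-j}]` differs from the Toeplitz matrix of the `p`-fold convolution of `a` by a
matrix whose entries have a sum of absolute values `o(n)`; its normalized trace therefore tends to
the mean of the `p`-th power of the symbol.

The hypothesis `N → ∞` does not force `n₂ → ∞`. However, `1/r = o(1)` gives `h_x → 0`, hence
`n₁ → ∞`, and along discretizations with bounded `n₂` also `s/r = h_x^α / h_y^β → 0`, so that the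
`y`-part disappears from matrix and symbol alike wherever it is not governed by its symbol.

The symbols are nonnegative because the Fourier coefficients of `q_γ` are nonpositive away from `0`
and have a nonnegative sum.
-/

/-! ### Trigonometric series -/

/-- The trigonometric series `∑_{k ∈ ℤ} a_k e^{i k ξ}`, the symbol of the Toeplitz matrices
`[a_{i-j}]`. -/
noncomputable def trigSum (a : ℤ → ℂ) (ξ : ℝ) : ℂ :=
  ∑' k : ℤ, a k * Complex.exp (Complex.I * k * ξ)

theorem norm_exp_I_mul_intCast_mul_ofReal (k : ℤ) (ξ : ℝ) :
    ‖Complex.exp (Complex.I * k * ξ)‖ = 1 := by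
  rw [mul_assoc, ← Complex.ofReal_intCast, ← Complex.ofReal_mul, Complex.norm_exp_I_mul_ofReal]

section TrigSum

variable {a b : ℤ → ℂ}

theorem summable_norm_trigSum (ha : Summable a) (ξ : ℝ) :
    Summable fun k : ℤ => ‖a k * Complex.exp (Complex.I * k * ξ)‖ := by
  simpa only [norm_mul, norm_exp_I_mul_intCast_mul_ofReal, mul_one] using ha.norm

theorem norm_trigSum_le (ha : Summable a) (ξ : ℝ) : ‖trigSum a ξ‖ ≤ ∑' k, ‖a k‖ := by
  simpa only [trigSum, norm_mul, norm_exp_I_mul_intCast_mul_ofReal, mul_one] using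
    norm_tsum_le_tsum_norm (summable_norm_trigSum ha ξ)

theorem continuous_trigSum (ha : Summable a) : Continuous (trigSum a) := by
  refine continuous_tsum (fun k => by fun_prop) ha.norm fun k ξ => ?_
  rw [norm_mul, norm_exp_I_mul_intCast_mul_ofReal, mul_one]

theorem trigSum_add (ha : Summable a) (hb : Summable b) (ξ : ℝ) :
    trigSum (fun k => a k + b k) ξ = trigSum a ξ + trigSum b ξ := by
  simp only [trigSum, add_mul]
  exact (summable_norm_trigSum ha ξ).of_norm.tsum_add (summable_norm_trigSum hb ξ).of_norm

theorem trigSum_const_mul (c : ℂ) (a : ℤ → ℂ) (ξ : ℝ) :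
    trigSum (fun k => c * a k) ξ = c * trigSum a ξ := by
  simp only [trigSum, mul_assoc, tsum_mul_left]

theorem trigSum_neg_right (a : ℤ → ℂ) (ξ : ℝ) :
    trigSum a (-ξ) = trigSum (fun k => a (-k)) ξ := by
  rw [trigSum, trigSum, ← (Equiv.neg ℤ).tsum_eq]
  refine tsum_congr fun k => ?_
  simp only [Equiv.neg_apply, Int.cast_neg, Complex.ofReal_neg, mul_neg, neg_mul, neg_neg]

theorem conj_trigSum (a : ℤ → ℂ) (ξ : ℝ) :
    starRingEnd ℂ (trigSum a ξ) = trigSum (fun k => starRingEnd ℂ (a k)) (-ξ) := by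
  rw [trigSum, trigSum, Complex.conj_tsum]
  refine tsum_congr fun k => ?_
  simp only [map_mul, ← Complex.exp_conj, Complex.conj_I, Complex.conj_ofReal, map_intCast,
    Complex.ofReal_neg, mul_neg, neg_mul]

theorem im_trigSum_eq_zero (ha : ∀ k, a (-k) = starRingEnd ℂ (a k)) (ξ : ℝ) :
    (trigSum a ξ).im = 0 := by
  rw [← Complex.conj_eq_iff_im, conj_trigSum, trigSum_neg_right]
  simp only [ha, Complex.conj_conj]

theorem re_trigSum_nonneg {c : ℤ → ℝ} (hc : Summable c) (hsum : 0 ≤ ∑' k, c k)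
    (hneg : ∀ k ≠ 0, c k ≤ 0) (ξ : ℝ) : 0 ≤ (trigSum (fun k => (c k : ℂ)) ξ).re := by
  have hre : HasSum (fun k : ℤ => c k * Real.cos (k * ξ)) (trigSum (fun k => (c k : ℂ)) ξ).re := by
    have hsummable := (summable_norm_trigSum (Complex.hasSum_ofReal.2 hc.hasSum).summable ξ).of_norm
    refine (Complex.hasSum_re hsummable.hasSum).congr_fun fun k => ?_
    rw [Complex.re_ofReal_mul, mul_assoc, mul_comm Complex.I, ← Complex.ofReal_intCast,
      ← Complex.ofReal_mul, Complex.exp_ofReal_mul_I_re]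
  refine hsum.trans (hasSum_le (fun k => ?_) hc.hasSum hre)
  rcases eq_or_ne k 0 with rfl | hk
  · simp only [Int.cast_zero, zero_mul, Real.cos_zero, mul_one, le_refl]
  · exact le_mul_of_le_one_right (hneg k hk) (Real.cos_le_one _)

end TrigSum

/-! ### The weights of the difference formula -/

theorem gCoeff_zero (γ : ℝ) : gCoeff γ 0 = 1 := by
  simp only [gCoeff, pow_zero, Nat.factorial_zero, Nat.cast_one, div_one, Finset.range_zero,
    Finset.prod_empty, mul_one]

theorem succ_mul_gCoeff_succ (γ : ℝ) (k : ℕ) :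
    ((k : ℝ) + 1) * gCoeff γ (k + 1) = (k - γ) * gCoeff γ k := by
  have hfactorial : (k.factorial : ℝ) ≠ 0 := by positivity
  have hsucc : (k : ℝ) + 1 ≠ 0 := by positivity
  simp only [gCoeff, Finset.prod_range_succ, Nat.factorial_succ, pow_succ, Nat.cast_mul,
    Nat.cast_succ]
  field_simp
  ring

theorem gCoeff_one (γ : ℝ) : gCoeff γ 1 = -γ := by
  have h := succ_mul_gCoeff_succ γ 0
  norm_num [gCoeff_zero] at h
  exact h

theorem gCoeff_two (γ : ℝ) : gCoeff γ 2 = γ * (γ - 1) / 2 := by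
  have h := succ_mul_gCoeff_succ γ 1
  norm_num [gCoeff_one] at h
  linarith

theorem mul_sum_range_succ_gCoeff (γ : ℝ) (n : ℕ) :
    γ * ∑ k ∈ Finset.range (n + 1), gCoeff γ k = (γ - n) * gCoeff γ n := by
  induction n with
  | zero => simp only [zero_add, Finset.sum_range_one, CharP.cast_eq_zero, sub_zero]
  | succ n ih =>
    rw [Finset.sum_range_succ, mul_add, ih]
    push_cast
    linarith [succ_mul_gCoeff_succ γ n]

section Weights

variable {γ : ℝ}

theorem gCoeff_add_two_nonneg (hγ : γ ∈ Icc (1 : ℝ) 2) (k : ℕ) : 0 ≤ gCoeff γ (k + 2) := by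
  obtain ⟨h₁, h₂⟩ := hγ
  induction k with
  | zero =>
    rw [gCoeff_two]
    have : 0 ≤ γ - 1 := sub_nonneg.2 h₁
    positivity
  | succ k ih =>
    have hrec := succ_mul_gCoeff_succ γ (k + 2)
    push_cast at hrec
    have hmul : 0 ≤ ((k : ℝ) + 2 + 1) * gCoeff γ (k + 2 + 1) :=
      hrec ▸ mul_nonneg (by linarith [k.cast_nonneg (α := ℝ)]) ih
    exact nonneg_of_mul_nonneg_right hmul (by positivity)

theorem sum_range_gCoeff_nonpos (hγ : γ ∈ Icc (1 : ℝ) 2) (n : ℕ) :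
    ∑ k ∈ Finset.range (n + 3), gCoeff γ k ≤ 0 := by
  have hmul : γ * ∑ k ∈ Finset.range (n + 3), gCoeff γ k ≤ 0 := by
    rw [mul_sum_range_succ_gCoeff γ (n + 2)]
    refine mul_nonpos_of_nonpos_of_nonneg ?_ (gCoeff_add_two_nonneg hγ n)
    push_cast
    linarith [hγ.2, n.cast_nonneg (α := ℝ)]
  exact nonpos_of_mul_nonpos_right hmul (by linarith [hγ.1])

theorem summable_gCoeff (hγ : γ ∈ Icc (1 : ℝ) 2) : Summable (gCoeff γ) := by
  rw [← summable_nat_add_iff 2]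
  refine summable_of_sum_range_le (c := γ - 1) (gCoeff_add_two_nonneg hγ) fun n => ?_
  have hsum := sum_range_gCoeff_nonpos hγ n
  rw [Finset.sum_range_succ, Finset.sum_range_succ', Finset.sum_range_succ', zero_add,
    gCoeff_zero, gCoeff_one] at hsum
  linarith [gCoeff_add_two_nonneg hγ n]

theorem tsum_gCoeff_nonpos (hγ : γ ∈ Icc (1 : ℝ) 2) : ∑' k, gCoeff γ k ≤ 0 :=
  le_of_tendsto' ((summable_gCoeff hγ).hasSum.tendsto_sum_nat.comp (tendsto_add_atTop_nat 3))
    (sum_range_gCoeff_nonpos hγ)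

theorem hasSum_wCoeff (hγ : γ ∈ Icc (1 : ℝ) 2) : HasSum (wCoeff γ) (∑' k, gCoeff γ k) := by
  have hg := (summable_gCoeff hγ).hasSum
  have hg_succ : HasSum (fun k => gCoeff γ (k + 1)) (∑' k, gCoeff γ k - gCoeff γ 0) := by
    simpa only [Finset.sum_range_one] using (hasSum_nat_add_iff' 1).2 hg
  have hw := (hg_succ.mul_left (γ / 2)).add (hg.mul_left ((2 - γ) / 2))
  have hvalue : γ / 2 * (∑' k, gCoeff γ k - gCoeff γ 0) + (2 - γ) / 2 * ∑' k, gCoeff γ k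
      = ∑' k, gCoeff γ k - wCoeff γ 0 := by
    rw [wCoeff]
    ring
  rw [← hasSum_nat_add_iff' 1, Finset.sum_range_one, ← hvalue]
  exact hw

theorem wCoeff_add_three_nonneg (hγ : γ ∈ Icc (1 : ℝ) 2) (k : ℕ) : 0 ≤ wCoeff γ (k + 3) := by
  have h₁ : 0 ≤ γ := zero_le_one.trans hγ.1
  have h₂ : 0 ≤ 2 - γ := sub_nonneg.2 hγ.2
  have hg₁ := gCoeff_add_two_nonneg hγ (k + 1)
  have hg₂ := gCoeff_add_two_nonneg hγ k
  rw [wCoeff]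
  positivity

theorem wCoeff_zero_add_wCoeff_two_nonneg (hγ : γ ∈ Ici (1 : ℝ)) :
    0 ≤ wCoeff γ 0 + wCoeff γ 2 := by
  have h₁ : 0 ≤ γ - 1 := sub_nonneg.2 hγ
  have h₀ : 0 ≤ γ := zero_le_one.trans hγ
  have hfactor : wCoeff γ 0 + wCoeff γ 2 = γ * (γ - 1) * (γ + 2) / 4 := by
    simp only [wCoeff, gCoeff_zero, Nat.reduceAdd, gCoeff_one, gCoeff_two]
    ring
  rw [hfactor]
  positivity

end Weights

/-- The Fourier coefficients of `f_γ`: the weights, negated and shifted so as to start at the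
index `-1`, and zero below it. -/
noncomputable def fCoeff (γ : ℝ) : ℤ → ℝ :=
  Function.extend (fun k : ℕ => (k : ℤ) - 1) (fun k => -wCoeff γ k) 0

/-- The Fourier coefficients of `q_γ`. -/
noncomputable def qCoeff (γ : ℝ) (k : ℤ) : ℝ := fCoeff γ k + fCoeff γ (-k)

theorem natCast_sub_one_injective : Function.Injective fun k : ℕ => (k : ℤ) - 1 :=
  fun _ _ h => Nat.cast_injective (sub_left_injective h)

theorem fCoeff_natCast_sub_one (γ : ℝ) (k : ℕ) : fCoeff γ (k - 1) = -wCoeff γ k :=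
  natCast_sub_one_injective.extend_apply _ _ k

theorem fCoeff_of_lt (γ : ℝ) {k : ℤ} (hk : k < -1) : fCoeff γ k = 0 :=
  Function.extend_apply' _ _ _ fun ⟨m, hm⟩ => by lia

theorem toepA_apply_eq_fCoeff (γ : ℝ) {n : ℕ} (i j : Fin n) :
    toepA γ n i j = fCoeff γ ((i : ℤ) - j) := by
  rw [toepA, Matrix.of_apply]
  split_ifs with hij
  · rw [← fCoeff_natCast_sub_one]
    congr 1
    lia
  · exact (fCoeff_of_lt γ (by lia)).symm

theorem qCoeff_neg (γ : ℝ) (k : ℤ) : qCoeff γ (-k) = qCoeff γ k := by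
  rw [qCoeff, qCoeff, neg_neg, add_comm]

theorem ofReal_mul_qCoeff_neg (c γ : ℝ) (k : ℤ) :
    (c : ℂ) * qCoeff γ (-k) = starRingEnd ℂ (c * qCoeff γ k) := by
  rw [qCoeff_neg, ← Complex.ofReal_mul, Complex.conj_ofReal]

theorem fSymbol_eq_trigSum (γ ξ : ℝ) : fSymbol γ ξ = trigSum (fun k => (fCoeff γ k : ℂ)) ξ := by
  rw [fSymbol, trigSum, ← tsum_neg, ← natCast_sub_one_injective.tsum_eq]
  · refine tsum_congr fun k => ?_
    rw [fCoeff_natCast_sub_one]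
    push_cast
    ring
  · intro k hk
    by_contra hrange
    exact hk (by simp only [fCoeff, Function.extend_apply' _ _ _ hrange, Pi.zero_apply,
      Complex.ofReal_zero, zero_mul])

section Coefficients

variable {γ : ℝ}

theorem hasSum_fCoeff (hγ : γ ∈ Icc (1 : ℝ) 2) : HasSum (fCoeff γ) (-∑' k, gCoeff γ k) :=
  (hasSum_extend_zero natCast_sub_one_injective).2 (hasSum_wCoeff hγ).neg

theorem hasSum_qCoeff (hγ : γ ∈ Icc (1 : ℝ) 2) :
    HasSum (qCoeff γ) (-∑' k, gCoeff γ k + -∑' k, gCoeff γ k) :=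
  (hasSum_fCoeff hγ).add ((Equiv.neg ℤ).hasSum_iff.2 (hasSum_fCoeff hγ))

theorem tsum_qCoeff_nonneg (hγ : γ ∈ Icc (1 : ℝ) 2) : 0 ≤ ∑' k, qCoeff γ k := by
  rw [(hasSum_qCoeff hγ).tsum_eq]
  linarith [tsum_gCoeff_nonpos hγ]

theorem summable_ofReal_qCoeff (hγ : γ ∈ Icc (1 : ℝ) 2) :
    Summable fun k => (qCoeff γ k : ℂ) :=
  (Complex.hasSum_ofReal.2 (hasSum_qCoeff hγ)).summable

theorem qCoeff_natCast_add_one_nonpos (hγ : γ ∈ Icc (1 : ℝ) 2) (n : ℕ) :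
    qCoeff γ (n + 1) ≤ 0 := by
  have hleft : fCoeff γ (n + 1) = -wCoeff γ (n + 2) := by
    rw [← fCoeff_natCast_sub_one]
    congr 1
    lia
  rw [qCoeff, hleft]
  rcases n with _ | n
  · have hright := fCoeff_natCast_sub_one γ 0
    norm_num at hright ⊢
    linarith [wCoeff_zero_add_wCoeff_two_nonneg hγ.1]
  · rw [fCoeff_of_lt γ (by lia)]
    linarith [wCoeff_add_three_nonneg hγ n]

theorem qCoeff_nonpos (hγ : γ ∈ Icc (1 : ℝ) 2) {k : ℤ} (hk : k ≠ 0) : qCoeff γ k ≤ 0 := by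
  wlog hpos : 0 < k generalizing k
  · rw [← qCoeff_neg]
    exact this (neg_ne_zero.2 hk) (by lia)
  · obtain ⟨n, rfl⟩ : ∃ n : ℕ, k = n + 1 := ⟨(k - 1).toNat, by lia⟩
    exact qCoeff_natCast_add_one_nonpos hγ n

theorem qSymbol_eq_trigSum (hγ : γ ∈ Icc (1 : ℝ) 2) :
    qSymbol γ = trigSum fun k => (qCoeff γ k : ℂ) := by
  have hf := (Complex.hasSum_ofReal.2 (hasSum_fCoeff hγ)).summable
  funext ξ
  simp only [qSymbol, fSymbol_eq_trigSum, trigSum_neg_right, qCoeff, Complex.ofReal_add]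
  exact (trigSum_add hf ((Equiv.neg ℤ).summable_iff.2 hf) ξ).symm

theorem fSymbol_neg (γ ξ : ℝ) : fSymbol γ (-ξ) = starRingEnd ℂ (fSymbol γ ξ) := by
  simp only [fSymbol_eq_trigSum, conj_trigSum, Complex.conj_ofReal]

theorem im_qSymbol (γ ξ : ℝ) : (qSymbol γ ξ).im = 0 := by
  rw [qSymbol, fSymbol_neg, Complex.add_im, Complex.conj_im, add_neg_cancel]

theorem re_qSymbol_nonneg (hγ : γ ∈ Icc (1 : ℝ) 2) (ξ : ℝ) : 0 ≤ (qSymbol γ ξ).re := by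
  rw [qSymbol_eq_trigSum hγ]
  exact re_trigSum_nonneg (hasSum_qCoeff hγ).summable (tsum_qCoeff_nonneg hγ)
    (fun _ => qCoeff_nonpos hγ) ξ

theorem continuous_qSymbol (hγ : γ ∈ Icc (1 : ℝ) 2) : Continuous (qSymbol γ) := by
  rw [qSymbol_eq_trigSum hγ]
  exact continuous_trigSum (summable_ofReal_qCoeff hγ)

end Coefficients

/-! ### Convolution of Fourier coefficients -/

/-- Convolution of two sequences indexed by `ℤ`; it multiplies the trigonometric series. -/
noncomputable def conv (a b : ℤ → ℂ) (k : ℤ) : ℂ := ∑' m, a m * b (k - m)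

/-- Convolution powers of a sequence indexed by `ℤ`: the Fourier coefficients of the powers of its
trigonometric series. -/
noncomputable def convPow (a : ℤ → ℂ) : ℕ → ℤ → ℂ
  | 0 => Pi.single 0 1
  | p + 1 => conv (convPow a p) a

/-- The bijection `(k, m) ↦ (m, k - m)` of `ℤ × ℤ`, which turns a product of two sums into a sum of
convolutions. -/
def convEquiv : ℤ × ℤ ≃ ℤ × ℤ :=
  (Equiv.prodComm ℤ ℤ).trans ((Equiv.refl ℤ).prodShear Equiv.subRight)

section Convolution

variable {a b : ℤ → ℂ}

theorem summable_norm_conv_terms (ha : Summable a) (hb : Summable b) :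
    Summable fun p : ℤ × ℤ => ‖a p.2 * b (p.1 - p.2)‖ :=
  convEquiv.summable_iff.2 (Summable.mul_norm ha.norm hb.norm)

theorem summable_conv (ha : Summable a) (hb : Summable b) : Summable (conv a b) :=
  (summable_norm_conv_terms ha hb).of_norm.prod

theorem trigSum_conv (ha : Summable a) (hb : Summable b) (ξ : ℝ) :
    trigSum (conv a b) ξ = trigSum a ξ * trigSum b ξ := by
  have hsummable := Summable.mul_norm (summable_norm_trigSum ha ξ) (summable_norm_trigSum hb ξ)
  have hexp (k m : ℤ) : Complex.exp (Complex.I * k * ξ)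
      = Complex.exp (Complex.I * m * ξ) * Complex.exp (Complex.I * (k - m : ℤ) * ξ) := by
    rw [← Complex.exp_add]
    push_cast
    ring_nf
  rw [trigSum, trigSum, trigSum, tsum_mul_tsum_of_summable_norm (summable_norm_trigSum ha ξ)
    (summable_norm_trigSum hb ξ), ← convEquiv.tsum_eq]
  refine Eq.trans (tsum_congr fun k => ?_)
    (convEquiv.summable_iff.2 hsummable.of_norm).tsum_prod.symm
  rw [conv, ← tsum_mul_right]
  exact tsum_congr fun m => by rw [hexp k m]; exact mul_mul_mul_comm _ _ _ _

theorem summable_convPow (ha : Summable a) (p : ℕ) : Summable (convPow a p) := by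
  induction p with
  | zero => exact (hasSum_pi_single (0 : ℤ) (1 : ℂ)).summable
  | succ p ih => exact summable_conv ih ha

theorem trigSum_single_zero (ξ : ℝ) : trigSum (Pi.single 0 1) ξ = 1 := by
  rw [trigSum, tsum_eq_single 0 fun k hk => by rw [Pi.single_eq_of_ne hk, zero_mul]]
  simp only [Pi.single_eq_same, Int.cast_zero, mul_zero, zero_mul, Complex.exp_zero, mul_one]

theorem trigSum_convPow (ha : Summable a) (p : ℕ) (ξ : ℝ) :
    trigSum (convPow a p) ξ = trigSum a ξ ^ p := by
  induction p with
  | zero => rw [pow_zero, convPow, trigSum_single_zero]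
  | succ p ih => rw [pow_succ, ← ih, convPow, trigSum_conv (summable_convPow ha p) ha]

theorem setIntegral_exp_I_mul_intCast_mul (k : ℤ) :
    ∫ ξ : ℝ in Icc (-Real.pi) Real.pi, Complex.exp (Complex.I * k * ξ)
      = if k = 0 then ((2 * Real.pi : ℝ) : ℂ) else 0 := by
  rw [integral_Icc_eq_integral_Ioc,
    ← intervalIntegral.integral_of_le (by linarith [Real.pi_pos])]
  split_ifs with hk
  · simp only [hk, Int.cast_zero, mul_zero, zero_mul, Complex.exp_zero,
      intervalIntegral.integral_const, sub_neg_eq_add, ← two_mul, Complex.real_smul, mul_one]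
  · rw [integral_exp_mul_complex (mul_ne_zero Complex.I_ne_zero (Int.cast_ne_zero.2 hk)),
      div_eq_zero_iff, sub_eq_zero, Complex.exp_eq_exp_iff_exists_int]
    exact Or.inl ⟨k, by push_cast; ring⟩

theorem volume_real_Icc_neg_pi_pi : volume.real (Icc (-Real.pi) Real.pi) = 2 * Real.pi := by
  rw [Real.volume_real_Icc_of_le (by linarith [Real.pi_pos]), sub_neg_eq_add, two_mul]

theorem symbolMean_trigSum (ha : Summable a) :
    symbolMean (trigSum a) (Icc (-Real.pi) Real.pi) (fun z => z) = a 0 := by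
  have hsum := hasSum_integral_of_summable_integral_norm
    (μ := (volume : Measure ℝ).restrict (Icc (-Real.pi) Real.pi))
    (F := fun (k : ℤ) (ξ : ℝ) => a k * Complex.exp (Complex.I * k * ξ))
    (fun k => (by fun_prop : Continuous _).integrableOn_Icc) (by
      simp only [norm_mul, norm_exp_I_mul_intCast_mul_ofReal, mul_one, integral_const]
      exact ha.norm.const_smul _)
  simp only [integral_const_mul, setIntegral_exp_I_mul_intCast_mul] at hsum
  have hintegral : ∫ ξ in Icc (-Real.pi) Real.pi, trigSum a ξ = a 0 * ((2 * Real.pi : ℝ) : ℂ) := by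
    have hsingle := hsum.unique (hasSum_single 0 fun k hk => by rw [if_neg hk, mul_zero])
    rwa [if_pos rfl] at hsingle
  have hpi : ((2 * Real.pi : ℝ) : ℂ) ≠ 0 := by exact_mod_cast Real.two_pi_pos.ne'
  rw [symbolMean, hintegral, volume_real_Icc_neg_pi_pi, mul_comm, mul_inv_cancel_right₀ hpi]

theorem symbolMean_trigSum_pow (ha : Summable a) (p : ℕ) :
    symbolMean (trigSum a) (Icc (-Real.pi) Real.pi) (fun z => z ^ p) = convPow a p 0 := by
  rw [← symbolMean_trigSum (summable_convPow ha p)]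
  simp only [symbolMean, trigSum_convPow ha]

end Convolution

/-! ### Toeplitz matrices -/

/-- The sum of the absolute values of the entries of a matrix: an error whose entry sum is `o(n)`
does not contribute to the limit of normalized traces. -/
noncomputable def entrySum {m n : Type*} [Fintype m] [Fintype n] (E : Matrix m n ℂ) : ℝ :=
  ∑ i, ∑ j, ‖E i j‖

/-- The Toeplitz matrix `[a_{i-j}]` of order `n`. -/
def toeplitz (a : ℤ → ℂ) (n : ℕ) : Matrix (Fin n) (Fin n) ℂ :=
  Matrix.of fun i j => a ((i : ℤ) - j)

/-- The mass of a sequence outside `[-n, n]`. -/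
noncomputable def tailSum (a : ℤ → ℂ) (n : ℕ) : ℝ :=
  ∑' k, ‖a k‖ - ∑ k ∈ Finset.Icc (-n : ℤ) n, ‖a k‖

section OperatorNorm

open scoped Matrix.Norms.Operator

variable {l m n : Type*} [Fintype l] [Fintype m] [Fintype n]

theorem sum_norm_row_le_linfty_opNorm (A : Matrix m n ℂ) (i : m) : ∑ j, ‖A i j‖ ≤ ‖A‖ := by
  rw [Matrix.linfty_opNorm_def]
  simp only [← coe_nnnorm, ← NNReal.coe_sum]
  exact_mod_cast Finset.le_sup (f := fun i => ∑ j, ‖A i j‖₊) (Finset.mem_univ i)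

theorem linfty_opNorm_le {A : Matrix m n ℂ} {C : ℝ} (hC : 0 ≤ C)
    (hA : ∀ i, ∑ j, ‖A i j‖ ≤ C) : ‖A‖ ≤ C := by
  lift C to NNReal using hC
  simp only [← coe_nnnorm, ← NNReal.coe_sum, NNReal.coe_le_coe] at hA
  rw [Matrix.linfty_opNorm_def, NNReal.coe_le_coe]
  exact Finset.sup_le fun i _ => hA i

theorem entrySum_add_le (E F : Matrix m n ℂ) : entrySum (E + F) ≤ entrySum E + entrySum F := by
  simp only [entrySum, ← Finset.sum_add_distrib]
  exact Finset.sum_le_sum fun i _ => Finset.sum_le_sum fun j _ => norm_add_le _ _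

theorem entrySum_mul_le (E : Matrix l m ℂ) (T : Matrix m n ℂ) :
    entrySum (E * T) ≤ entrySum E * ‖T‖ := by
  rw [entrySum, entrySum, Finset.sum_mul]
  refine Finset.sum_le_sum fun i _ => ?_
  calc ∑ j, ‖(E * T) i j‖ ≤ ∑ j, ∑ k, ‖E i k‖ * ‖T k j‖ := by
        refine Finset.sum_le_sum fun j _ => (norm_sum_le _ _).trans_eq ?_
        simp only [norm_mul]
    _ = ∑ k, ‖E i k‖ * ∑ j, ‖T k j‖ := by
        rw [Finset.sum_comm]
        simp only [Finset.mul_sum]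
    _ ≤ (∑ k, ‖E i k‖) * ‖T‖ := by
        rw [Finset.sum_mul]
        gcongr with k
        exact sum_norm_row_le_linfty_opNorm T k

theorem norm_trace_le_entrySum (E : Matrix n n ℂ) : ‖E.trace‖ ≤ entrySum E :=
  (norm_sum_le _ _).trans <| Finset.sum_le_sum fun i _ =>
    Finset.single_le_sum (f := fun j => ‖E i j‖) (fun _ _ => norm_nonneg _) (Finset.mem_univ i)

theorem sum_norm_le_tsum_norm {ι : Type*} [Fintype ι] {a : ℤ → ℂ} (ha : Summable a) {f : ι → ℤ}
    (hf : Function.Injective f) : ∑ i, ‖a (f i)‖ ≤ ∑' k, ‖a k‖ := by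
  have hle := ha.norm.sum_le_tsum (Finset.univ.map ⟨f, hf⟩) fun k _ => norm_nonneg _
  rwa [Finset.sum_map] at hle

theorem linfty_opNorm_toeplitz_le {a : ℤ → ℂ} (ha : Summable a) (n : ℕ) :
    ‖toeplitz a n‖ ≤ ∑' k, ‖a k‖ :=
  linfty_opNorm_le (tsum_nonneg fun _ => norm_nonneg _) fun i =>
    sum_norm_le_tsum_norm ha fun j j' h => by simpa [Fin.ext_iff] using h

end OperatorNorm

section Toeplitz

variable {a b : ℤ → ℂ}

theorem entrySum_nonneg {m n : Type*} [Fintype m] [Fintype n] (E : Matrix m n ℂ) :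
    0 ≤ entrySum E := by
  unfold entrySum
  positivity

theorem isHermitian_toeplitz (ha : ∀ k, a (-k) = starRingEnd ℂ (a k)) (n : ℕ) :
    (toeplitz a n).IsHermitian := by
  ext i j
  rw [Matrix.conjTranspose_apply, toeplitz, Matrix.of_apply, Matrix.of_apply, ← neg_sub (i : ℤ), ha]
  exact Complex.conj_conj _

theorem trace_toeplitz (a : ℤ → ℂ) (n : ℕ) : (toeplitz a n).trace = n * a 0 := by
  simp only [Matrix.trace, Matrix.diag_apply, toeplitz, Matrix.of_apply, sub_self,
    Finset.sum_const, Finset.card_univ, Fintype.card_fin, nsmul_eq_mul]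

theorem tendsto_tailSum (ha : Summable a) : Tendsto (tailSum a) atTop (𝓝 0) := by
  have hsum := ha.norm.hasSum.comp (Finset.tendsto_Icc_neg (R := ℤ))
  rw [← sub_self (∑' k, ‖a k‖)]
  exact hsum.const_sub _

theorem tsum_norm_sub_sum_Icc_le (ha : Summable a) (i j : ℕ) :
    ∑' k, ‖a k‖ - ∑ k ∈ Finset.Icc (-i : ℤ) j, ‖a k‖ ≤ tailSum a i + tailSum a j := by
  have hunion := Finset.sum_union_inter (s₁ := Finset.Icc (-i : ℤ) i)
    (s₂ := Finset.Icc (-j : ℤ) j) (f := fun k => ‖a k‖)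
  have htotal := ha.norm.sum_le_tsum (Finset.Icc (-i : ℤ) i ∪ Finset.Icc (-j : ℤ) j)
    fun k _ => norm_nonneg _
  have hinter : ∑ k ∈ Finset.Icc (-i : ℤ) i ∩ Finset.Icc (-j : ℤ) j, ‖a k‖
      ≤ ∑ k ∈ Finset.Icc (-i : ℤ) j, ‖a k‖ :=
    Finset.sum_le_sum_of_subset_of_nonneg
      (fun k hk => by simp only [Finset.mem_inter, Finset.mem_Icc] at hk ⊢; lia)
      fun k _ _ => norm_nonneg _
  simp only [tailSum]
  linarith

theorem sum_fin_eq_sum_Ico {M : Type*} [AddCommMonoid M] (f : ℤ → M) (n : ℕ) :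
    ∑ l : Fin n, f l = ∑ l ∈ Finset.Ico (0 : ℤ) n, f l :=
  Finset.sum_bij (fun l _ => (l : ℤ)) (fun l _ => Finset.mem_Ico.2 (by have := l.isLt; lia))
    (fun l _ l' _ h => Fin.ext (by lia))
    (fun k hk => have hk := Finset.mem_Ico.1 hk
      ⟨⟨k.toNat, by lia⟩, Finset.mem_univ _, Int.toNat_of_nonneg hk.1⟩) fun _ _ => rfl

theorem summable_norm_mul_sub (ha : Summable a) (hb : Summable b) (i j : ℤ) :
    Summable fun l => ‖a (i - l) * b (l - j)‖ := by
  have hsummable := (Equiv.subLeft i).summable_iff.2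
    ((summable_norm_conv_terms ha hb).prod_factor (i - j))
  refine hsummable.congr fun l => ?_
  rw [Function.comp_apply, Equiv.subLeft_apply, sub_sub_sub_cancel_left]

theorem conv_sub (a b : ℤ → ℂ) (i j : ℤ) : conv a b (i - j) = ∑' l, a (i - l) * b (l - j) := by
  rw [conv, ← (Equiv.subLeft i).tsum_eq]
  simp only [Equiv.subLeft_apply, sub_sub_sub_cancel_left]

theorem toeplitz_conv_sub_mul_apply (ha : Summable a) (hb : Summable b) {n : ℕ} (i j : Fin n) :
    (toeplitz (conv a b) n - toeplitz a n * toeplitz b n) i j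
      = ∑' l : ((Finset.Ico (0 : ℤ) n : Set ℤ)ᶜ : Set ℤ), a (i - l) * b (l - j) := by
  have hsplit := (summable_norm_mul_sub ha hb i j).of_norm.sum_add_tsum_compl
    (s := Finset.Ico (0 : ℤ) n)
  simp only [Matrix.sub_apply, Matrix.mul_apply, toeplitz, Matrix.of_apply, conv_sub, ← hsplit,
    ← sum_fin_eq_sum_Ico (fun l => a (i - l) * b (l - j)), add_sub_cancel_left]

theorem tsum_compl_Ico_norm_sub_le (hb : Summable b) {n : ℕ} (j : Fin n) :
    ∑' l : ((Finset.Ico (0 : ℤ) n : Set ℤ)ᶜ : Set ℤ), ‖b (l - j)‖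
      ≤ tailSum b j + tailSum b (n - 1 - j) := by
  have hshift : Summable fun l : ℤ => ‖b (l - j)‖ := (Equiv.subRight (j : ℤ)).summable_iff.2 hb.norm
  have hsplit := hshift.sum_add_tsum_compl (s := Finset.Ico (0 : ℤ) n)
  have hwindow : ∑ l ∈ Finset.Ico (0 : ℤ) n, ‖b (l - j)‖
      = ∑ k ∈ Finset.Icc (-(j : ℕ) : ℤ) (n - 1 - j : ℕ), ‖b k‖ := by
    refine Finset.sum_equiv (Equiv.subRight (j : ℤ)) (fun l => ?_) fun _ _ => rfl
    simp only [Finset.mem_Ico, Finset.mem_Icc, Equiv.subRight_apply]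
    have := j.isLt
    lia
  have htotal : ∑' l : ℤ, ‖b (l - j)‖ = ∑' k, ‖b k‖ :=
    (Equiv.subRight (j : ℤ)).tsum_eq fun k => ‖b k‖
  rw [htotal, hwindow] at hsplit
  linarith [tsum_norm_sub_sum_Icc_le hb j (n - 1 - j)]

theorem sum_norm_toeplitz_conv_sub_mul_le (ha : Summable a) (hb : Summable b) {n : ℕ}
    (j : Fin n) :
    ∑ i, ‖(toeplitz (conv a b) n - toeplitz a n * toeplitz b n) i j‖
      ≤ (∑' k, ‖a k‖) * (tailSum b j + tailSum b (n - 1 - j)) := by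
  set S : Set ℤ := (Finset.Ico (0 : ℤ) n : Set ℤ)ᶜ
  have hterms (i : Fin n) : Summable fun l : S => ‖a (i - l) * b (l - j)‖ :=
    (summable_norm_mul_sub ha hb i j).subtype S
  have hb_S : Summable fun l : S => ‖b (l - j)‖ :=
    ((Equiv.subRight (j : ℤ)).summable_iff.2 hb.norm).subtype S
  calc ∑ i, ‖(toeplitz (conv a b) n - toeplitz a n * toeplitz b n) i j‖
      ≤ ∑ i : Fin n, ∑' l : S, ‖a (i - l) * b (l - j)‖ := by
        refine Finset.sum_le_sum fun i _ => ?_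
        rw [toeplitz_conv_sub_mul_apply ha hb]
        exact norm_tsum_le_tsum_norm (hterms i)
    _ = ∑' l : S, ∑ i : Fin n, ‖a (i - l) * b (l - j)‖ :=
        (Summable.tsum_finsetSum fun i _ => hterms i).symm
    _ ≤ ∑' l : S, (∑' k, ‖a k‖) * ‖b (l - j)‖ := by
        refine (summable_sum fun i _ => hterms i).tsum_le_tsum (fun l => ?_) (hb_S.mul_left _)
        simp only [norm_mul, ← Finset.sum_mul]
        gcongr
        exact sum_norm_le_tsum_norm ha fun i i' h => by simpa [Fin.ext_iff] using h
    _ ≤ (∑' k, ‖a k‖) * (tailSum b j + tailSum b (n - 1 - j)) := by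
        rw [tsum_mul_left]
        gcongr
        exact tsum_compl_Ico_norm_sub_le hb j

theorem entrySum_toeplitz_conv_sub_mul_le (ha : Summable a) (hb : Summable b) (n : ℕ) :
    entrySum (toeplitz (conv a b) n - toeplitz a n * toeplitz b n)
      ≤ 2 * (∑' k, ‖a k‖) * ∑ j ∈ Finset.range n, tailSum b j := by
  calc entrySum (toeplitz (conv a b) n - toeplitz a n * toeplitz b n)
      ≤ ∑ j : Fin n, (∑' k, ‖a k‖) * (tailSum b j + tailSum b (n - 1 - j)) := by
        rw [entrySum, Finset.sum_comm]
        exact Finset.sum_le_sum fun j _ => sum_norm_toeplitz_conv_sub_mul_le ha hb j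
    _ = 2 * (∑' k, ‖a k‖) * ∑ j ∈ Finset.range n, tailSum b j := by
        rw [← Finset.mul_sum, Finset.sum_add_distrib, Fin.sum_univ_eq_sum_range,
          Fin.sum_univ_eq_sum_range fun j => tailSum b (n - 1 - j), Finset.sum_range_reflect]
        ring

theorem tendsto_entrySum_toeplitz_conv_sub_mul (ha : Summable a) (hb : Summable b) :
    Tendsto (fun n : ℕ => entrySum (toeplitz (conv a b) n - toeplitz a n * toeplitz b n) / n)
      atTop (𝓝 0) := by
  have hcesaro := (tendsto_tailSum hb).cesaro.const_mul (2 * ∑' k, ‖a k‖)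
  rw [mul_zero] at hcesaro
  refine squeeze_zero (fun n => div_nonneg (entrySum_nonneg _) n.cast_nonneg) (fun n => ?_) hcesaro
  rw [div_eq_inv_mul, mul_left_comm]
  gcongr
  exact entrySum_toeplitz_conv_sub_mul_le ha hb n

theorem toeplitz_single_zero (n : ℕ) : toeplitz (Pi.single 0 1) n = 1 := by
  ext i j
  simp only [toeplitz, Matrix.of_apply, Pi.single_apply, Matrix.one_apply, sub_eq_zero,
    Nat.cast_inj, Fin.ext_iff]

theorem tendsto_entrySum_toeplitz_convPow_sub_pow (ha : Summable a) (p : ℕ) :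
    Tendsto (fun n : ℕ => entrySum (toeplitz (convPow a p) n - toeplitz a n ^ p) / n)
      atTop (𝓝 0) := by
  induction p with
  | zero =>
    simp only [convPow, toeplitz_single_zero, pow_zero, sub_self, entrySum, Matrix.zero_apply,
      norm_zero, Finset.sum_const_zero, zero_div, tendsto_const_nhds]
  | succ p ih =>
    have hlim := (tendsto_entrySum_toeplitz_conv_sub_mul (summable_convPow ha p) ha).add
      (ih.mul_const (∑' k, ‖a k‖))
    rw [zero_mul, add_zero] at hlim
    refine squeeze_zero (fun n => div_nonneg (entrySum_nonneg _) n.cast_nonneg) (fun n => ?_) hlim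
    have hsplit : toeplitz (convPow a (p + 1)) n - toeplitz a n ^ (p + 1)
        = (toeplitz (conv (convPow a p) a) n - toeplitz (convPow a p) n * toeplitz a n)
          + (toeplitz (convPow a p) n - toeplitz a n ^ p) * toeplitz a n := by
      rw [convPow, pow_succ, sub_mul, sub_add_sub_cancel]
    rw [hsplit, div_mul_eq_mul_div, ← add_div]
    gcongr
    refine (entrySum_add_le _ _).trans ?_
    gcongr
    exact (entrySum_mul_le _ _).trans <|
      mul_le_mul_of_nonneg_left (linfty_opNorm_toeplitz_le ha n) (entrySum_nonneg _)

theorem tendsto_trace_toeplitz_pow_div (ha : Summable a) (p : ℕ) :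
    Tendsto (fun n : ℕ => (toeplitz a n ^ p).trace / n) atTop (𝓝 (convPow a p 0)) := by
  rw [tendsto_iff_norm_sub_tendsto_zero]
  refine squeeze_zero' (.of_forall fun n => norm_nonneg _) ?_
    (tendsto_entrySum_toeplitz_convPow_sub_pow ha p)
  filter_upwards [eventually_ne_atTop 0] with n hn
  have hn : (n : ℂ) ≠ 0 := Nat.cast_ne_zero.2 hn
  have htrace : convPow a p 0 = (toeplitz (convPow a p) n).trace / n := by
    rw [trace_toeplitz, mul_div_cancel_left₀ _ hn]
  rw [htrace, ← sub_div, ← Matrix.trace_sub, norm_div, Complex.norm_natCast, ← norm_neg,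
    ← Matrix.trace_neg, neg_sub]
  gcongr
  exact norm_trace_le_entrySum _

end Toeplitz

/-! ### The method of moments -/

section Means

variable {n : Type} [Fintype n] [DecidableEq n] (A : Matrix n n ℂ)

theorem eigMean_add (F H : ℂ → ℂ) :
    eigMean A (fun z => F z + H z) = eigMean A F + eigMean A H := by
  rw [eigMean, Multiset.sum_map_add, add_div]
  rfl

theorem eigMean_const_mul (c : ℂ) (F : ℂ → ℂ) :
    eigMean A (fun z => c * F z) = c * eigMean A F := by
  rw [eigMean, Multiset.sum_map_mul_left, mul_div_assoc]
  rfl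

theorem norm_eigMean_sub_le {F H : ℂ → ℂ} {ε : ℝ} (hε : 0 ≤ ε)
    (hFH : ∀ z ∈ A.charpoly.roots, ‖F z - H z‖ ≤ ε) : ‖eigMean A F - eigMean A H‖ ≤ ε := by
  have hcard : A.charpoly.roots.card = Fintype.card n := by
    rw [← (IsAlgClosed.splits A.charpoly).natDegree_eq_card_roots, A.charpoly_natDegree_eq_dim]
  rw [eigMean, eigMean, ← sub_div, ← Multiset.sum_map_sub, norm_div, Complex.norm_natCast]
  refine div_le_of_le_mul₀ (Nat.cast_nonneg _) hε ((norm_multiset_sum_le _).trans ?_)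
  rw [mul_comm, ← nsmul_eq_mul, ← hcard, ← Multiset.card_map (fun z => ‖F z - H z‖),
    Multiset.map_map]
  refine Multiset.sum_le_card_nsmul _ _ fun y hy => ?_
  obtain ⟨z, hz, rfl⟩ := Multiset.mem_map.1 hy
  exact hFH z hz

theorem eigMean_add_smul_one (t : ℂ) (F : ℂ → ℂ) :
    eigMean (A + t • 1) F = eigMean A fun z => F (z + t) := by
  have hcharpoly : A.charpoly
      = (A + t • 1).charpoly.comp (Polynomial.C 1 * Polynomial.X + Polynomial.C t) := by
    rw [map_one, one_mul, ← Matrix.charpoly_sub_scalar, Matrix.scalar_apply,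
      ← Matrix.smul_one_eq_diagonal, add_sub_cancel_right]
  have hroots := (A + t • 1).charpoly.map_roots_comp_C_mul_X_add_C 1 t isUnit_one
  simp only [← hcharpoly, one_mul] at hroots
  rw [eigMean, ← hroots, Multiset.map_map]
  rfl

variable {X : Type} [MeasureSpace X]

theorem symbolMean_const_mul (f : X → ℂ) (G : Set X) (c : ℂ) (F : ℂ → ℂ) :
    symbolMean f G (fun z => c * F z) = c * symbolMean f G F := by
  rw [symbolMean, integral_const_mul, mul_left_comm]
  rfl

variable [TopologicalSpace X] [OpensMeasurableSpace X]
  [IsFiniteMeasureOnCompacts (volume : Measure X)] {f : X → ℂ} {G : Set X}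

theorem tendsto_symbolMean {f : ℕ → X → ℂ} {g : X → ℂ} (hf : ∀ k, Continuous (f k))
    (hG : IsCompact G) (hfg : ∀ x, Tendsto (fun k => f k x) atTop (𝓝 (g x))) {F : ℂ → ℂ}
    (hF : Continuous F) (hFc : HasCompactSupport F) :
    Tendsto (fun k => symbolMean (f k) G F) atTop (𝓝 (symbolMean g G F)) := by
  obtain ⟨C, hC⟩ := hF.bounded_above_of_compact_support hFc
  have hconst : IntegrableOn (fun _ : X => C) G := integrableOn_const hG.measure_ne_top
  refine Tendsto.const_mul _ <| tendsto_integral_of_dominated_convergence (fun _ => C)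
    (fun k => (hF.comp (hf k)).measurable.aestronglyMeasurable) hconst
    (fun k => .of_forall fun x => hC _) (.of_forall fun x => (hF.tendsto _).comp (hfg x))

variable [T2Space X]

theorem symbolMean_add (hf : Continuous f) (hG : IsCompact G) {F H : ℂ → ℂ} (hF : Continuous F)
    (hH : Continuous H) :
    symbolMean f G (fun z => F z + H z) = symbolMean f G F + symbolMean f G H := by
  rw [symbolMean, integral_add ((hF.comp' hf).continuousOn.integrableOn_compact hG)
    ((hH.comp' hf).continuousOn.integrableOn_compact hG), mul_add]
  rfl

theorem norm_symbolMean_sub_le (hf : Continuous f) (hG : IsCompact G) {F H : ℂ → ℂ}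
    (hF : Continuous F) (hH : Continuous H) {ε : ℝ} (hε : 0 ≤ ε)
    (hFH : ∀ x ∈ G, ‖F (f x) - H (f x)‖ ≤ ε) :
    ‖symbolMean f G F - symbolMean f G H‖ ≤ ε := by
  rw [symbolMean, symbolMean, ← mul_sub,
    ← integral_sub ((hF.comp' hf).continuousOn.integrableOn_compact hG)
      ((hH.comp' hf).continuousOn.integrableOn_compact hG), norm_mul, norm_inv, Complex.norm_real,
    Real.norm_of_nonneg measureReal_nonneg, ← div_eq_inv_mul]
  exact div_le_of_le_mul₀ measureReal_nonneg hε
    (norm_setIntegral_le_of_norm_le_const hG.measure_lt_top hFH)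

end Means

section Hermitian

open scoped Matrix.Norms.Operator

variable {n : Type} [Fintype n] [DecidableEq n] {A : Matrix n n ℂ}

theorem trace_pow_eq_sum_eigenvalues_pow (hA : A.IsHermitian) (p : ℕ) :
    (A ^ p).trace = ∑ i, (hA.eigenvalues i : ℂ) ^ p := by
  conv_lhs => rw [hA.spectral_theorem]
  rw [← map_pow, Unitary.conjStarAlgAut_apply, Matrix.trace_mul_cycle, Unitary.coe_star_mul_self,
    one_mul, Matrix.diagonal_pow, Matrix.trace_diagonal]
  rfl

theorem eigMean_pow_eq_trace_div (hA : A.IsHermitian) (p : ℕ) :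
    eigMean A (fun z => z ^ p) = (A ^ p).trace / Fintype.card n := by
  rw [eigMean, hA.roots_charpoly_eq_eigenvalues, trace_pow_eq_sum_eigenvalues_pow hA,
    Multiset.map_map]
  rfl

theorem roots_charpoly_mem_Icc [Nonempty n] (hA : A.IsHermitian) {K : ℝ} (hK : ‖A‖ ≤ K) :
    ∀ z ∈ A.charpoly.roots, z ∈ Complex.ofReal '' Icc (-K) K := by
  intro z hz
  have hnorm : ‖z‖ ≤ ‖A‖ := spectrum.norm_le_norm_of_mem <|
    Matrix.mem_spectrum_iff_isRoot_charpoly.2 (Polynomial.isRoot_of_mem_roots hz)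
  rw [hA.roots_charpoly_eq_eigenvalues] at hz
  obtain ⟨i, -, rfl⟩ := Multiset.mem_map.1 hz
  refine ⟨hA.eigenvalues i, abs_le.1 ?_, rfl⟩
  simpa only [Function.comp_apply, RCLike.norm_ofReal] using hnorm.trans hK

end Hermitian

theorem exists_polynomial_norm_sub_eval_ofReal_lt {F : ℂ → ℂ} (hF : Continuous F) (K : ℝ)
    {ε : ℝ} (hε : 0 < ε) :
    ∃ P : Polynomial ℂ, ∀ x ∈ Icc (-K) K, ‖F x - P.eval (x : ℂ)‖ < ε := by
  have hF_ofReal := hF.comp Complex.continuous_ofReal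
  obtain ⟨Q, hQ⟩ := exists_polynomial_near_of_continuousOn (-K) K _
    (Complex.continuous_re.comp hF_ofReal).continuousOn (ε / 2) (half_pos hε)
  obtain ⟨R, hR⟩ := exists_polynomial_near_of_continuousOn (-K) K _
    (Complex.continuous_im.comp hF_ofReal).continuousOn (ε / 2) (half_pos hε)
  have heval (S : Polynomial ℝ) (x : ℝ) : (S.map Complex.ofRealHom).eval (x : ℂ) = S.eval x :=
    S.eval_map_apply Complex.ofRealHom x
  refine ⟨Q.map Complex.ofRealHom + Polynomial.C Complex.I * R.map Complex.ofRealHom,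
    fun x hx => ?_⟩
  have hparts := Complex.norm_le_abs_re_add_abs_im
    (F x - (Q.map Complex.ofRealHom + Polynomial.C Complex.I * R.map Complex.ofRealHom).eval ↑x)
  simp only [Polynomial.eval_add, Polynomial.eval_mul, Polynomial.eval_C, heval, Complex.sub_re,
    Complex.sub_im, Complex.add_re, Complex.add_im, Complex.I_mul_re, Complex.I_mul_im,
    Complex.ofReal_re, Complex.ofReal_im, neg_zero, add_zero, zero_add] at hparts ⊢
  have hre := hQ x hx
  have him := hR x hx
  rw [abs_sub_comm] at hre him
  simp only [Function.comp_apply] at hre him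
  linarith

section EigDistributedVarying

variable {n : ℕ → Type} [∀ k, Fintype (n k)] [∀ k, DecidableEq (n k)]
  {A : ∀ k, Matrix (n k) (n k) ℂ} {X : Type} [MeasureSpace X] {f : ℕ → X → ℂ} {G : Set X}

theorem EigDistributedVarying.add_smul_one (h : EigDistributedVarying A f G) {t : ℕ → ℂ}
    (ht : Tendsto t atTop (𝓝 0)) : EigDistributedVarying (fun k => A k + t k • 1) f G := by
  intro F hF hFc
  have hshift : Tendsto (fun k => eigMean (A k + t k • 1) F - eigMean (A k) F) atTop (𝓝 0) := by
    rw [Metric.tendsto_nhds]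
    intro ε hε
    obtain ⟨δ, hδ, huniform⟩ := Metric.uniformContinuous_iff.1
      (hF.uniformContinuous_of_tendsto_cocompact hFc.is_zero_at_infty) (ε / 2) (half_pos hε)
    filter_upwards [Metric.tendsto_nhds.1 ht δ hδ] with k hk
    rw [dist_zero_right] at hk ⊢
    rw [eigMean_add_smul_one]
    refine (norm_eigMean_sub_le _ (half_pos hε).le fun z _ => ?_).trans_lt (half_lt_self hε)
    rw [← dist_eq_norm]
    exact (huniform (by rwa [dist_eq_norm, add_sub_cancel_left])).le
  have hsum := hshift.add (h F hF hFc)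
  simpa only [sub_add_sub_cancel, add_zero] using hsum

variable [TopologicalSpace X] [OpensMeasurableSpace X]
  [IsFiniteMeasureOnCompacts (volume : Measure X)]

theorem EigDistributedVarying.eigDistributed (h : EigDistributedVarying A f G)
    (hf : ∀ k, Continuous (f k)) (hG : IsCompact G) {g : X → ℂ}
    (hfg : ∀ x, Tendsto (fun k => f k x) atTop (𝓝 (g x))) : EigDistributed A g G := by
  intro F hF hFc
  have hsum := (h F hF hFc).add (tendsto_symbolMean hf hG hfg hF hFc)
  simpa only [sub_add_cancel, zero_add] using hsum

variable [T2Space X]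

theorem tendsto_eigMean_eval_sub_symbolMean_eval (hf : ∀ k, Continuous (f k)) (hG : IsCompact G)
    (hmoments : ∀ p : ℕ, Tendsto (fun k => eigMean (A k) (fun z => z ^ p)
      - symbolMean (f k) G (fun z => z ^ p)) atTop (𝓝 0)) (P : Polynomial ℂ) :
    Tendsto (fun k => eigMean (A k) (fun z => P.eval z)
      - symbolMean (f k) G (fun z => P.eval z)) atTop (𝓝 0) := by
  induction P using Polynomial.induction_on' with
  | add P Q hP hQ =>
    have hsum := hP.add hQ
    simp only [Polynomial.eval_add, eigMean_add,
      symbolMean_add (hf _) hG P.continuous Q.continuous, add_sub_add_comm]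
    rwa [add_zero] at hsum
  | monomial p c =>
    simp only [Polynomial.eval_monomial, eigMean_const_mul, symbolMean_const_mul, ← mul_sub]
    rw [← mul_zero c]
    exact (hmoments p).const_mul c

theorem eigDistributedVarying_of_tendsto_moments (hf : ∀ k, Continuous (f k)) (hG : IsCompact G)
    {K : ℝ}
    (hA_mem : ∀ᶠ k in atTop, ∀ z ∈ (A k).charpoly.roots, z ∈ Complex.ofReal '' Icc (-K) K)
    (hf_mem : ∀ᶠ k in atTop, MapsTo (f k) G (Complex.ofReal '' Icc (-K) K))
    (hmoments : ∀ p : ℕ, Tendsto (fun k => eigMean (A k) (fun z => z ^ p)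
      - symbolMean (f k) G (fun z => z ^ p)) atTop (𝓝 0)) :
    EigDistributedVarying A f G := by
  intro F hF _
  rw [Metric.tendsto_nhds]
  intro ε hε
  have hε3 : 0 < ε / 3 := by positivity
  obtain ⟨P, hP⟩ := exists_polynomial_norm_sub_eval_ofReal_lt hF K hε3
  have happrox : ∀ z ∈ Complex.ofReal '' Icc (-K) K, ‖F z - P.eval z‖ ≤ ε / 3 := by
    rintro _ ⟨x, hx, rfl⟩
    exact (hP x hx).le
  have hpoly := tendsto_eigMean_eval_sub_symbolMean_eval hf hG hmoments P
  filter_upwards [hA_mem, hf_mem, Metric.tendsto_nhds.1 hpoly (ε / 3) hε3] with k hAk hfk hk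
  rw [dist_zero_right] at hk ⊢
  have hleft := norm_eigMean_sub_le (A k) (H := fun z => P.eval z) hε3.le
    fun z hz => happrox z (hAk z hz)
  have hright := norm_symbolMean_sub_le (hf k) hG hF P.continuous hε3.le
    fun x hx => happrox _ (hfk hx)
  calc ‖eigMean (A k) F - symbolMean (f k) G F‖
      = ‖(eigMean (A k) F - eigMean (A k) fun z => P.eval z)
          + (eigMean (A k) (fun z => P.eval z) - symbolMean (f k) G fun z => P.eval z)
          - (symbolMean (f k) G F - symbolMean (f k) G fun z => P.eval z)‖ := by
        congr 1
        ring
    _ ≤ ‖eigMean (A k) F - eigMean (A k) fun z => P.eval z‖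
          + ‖eigMean (A k) (fun z => P.eval z) - symbolMean (f k) G fun z => P.eval z‖
          + ‖symbolMean (f k) G F - symbolMean (f k) G fun z => P.eval z‖ :=
        (norm_sub_le _ _).trans (add_le_add_left (norm_add_le _ _) _)
    _ < ε := by linarith

end EigDistributedVarying

/-! ### Kronecker sums -/

section KroneckerSum

variable {m n : Type} [DecidableEq m] [DecidableEq n]

/-- The Kronecker sum `I ⊗ B + C ⊗ I`; its eigenvalues are the sums of those of `B` and `C`. The
index of `B` comes second, as the one running faster. -/
def kroneckerSum (B : Matrix m m ℂ) (C : Matrix n n ℂ) : Matrix (n × m) (n × m) ℂ :=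
  1 ⊗ₖ B + C ⊗ₖ 1

theorem isHermitian_kroneckerSum {B : Matrix m m ℂ} {C : Matrix n n ℂ} (hB : B.IsHermitian)
    (hC : C.IsHermitian) : (kroneckerSum B C).IsHermitian := by
  rw [Matrix.IsHermitian, kroneckerSum, Matrix.conjTranspose_add, Matrix.conjTranspose_kronecker,
    Matrix.conjTranspose_kronecker, Matrix.conjTranspose_one, Matrix.conjTranspose_one, hB.eq,
    hC.eq]

variable [Fintype m] [Fintype n]

theorem kronecker_pow (C : Matrix n n ℂ) (B : Matrix m m ℂ) (p : ℕ) :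
    (C ⊗ₖ B) ^ p = (C ^ p) ⊗ₖ (B ^ p) := by
  induction p with
  | zero => simp only [pow_zero, Matrix.one_kronecker_one]
  | succ p ih => rw [pow_succ, ih, ← Matrix.mul_kronecker_mul, ← pow_succ, ← pow_succ]

theorem trace_kroneckerSum_pow (B : Matrix m m ℂ) (C : Matrix n n ℂ) (p : ℕ) :
    (kroneckerSum B C ^ p).trace
      = ∑ i ∈ Finset.range (p + 1), p.choose i * ((B ^ i).trace * (C ^ (p - i)).trace) := by
  have hcomm : Commute ((1 : Matrix n n ℂ) ⊗ₖ B) (C ⊗ₖ (1 : Matrix m m ℂ)) := by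
    rw [commute_iff_eq, ← Matrix.mul_kronecker_mul, ← Matrix.mul_kronecker_mul, one_mul, mul_one,
      one_mul, mul_one]
  rw [kroneckerSum, hcomm.add_pow, Matrix.trace_sum]
  refine Finset.sum_congr rfl fun i _ => ?_
  rw [kronecker_pow, kronecker_pow, ← Matrix.mul_kronecker_mul, one_pow, one_pow, one_mul, mul_one,
    ← nsmul_eq_mul', Matrix.trace_smul, Matrix.trace_kronecker, nsmul_eq_mul,
    mul_comm (B ^ i).trace]

open scoped Matrix.Norms.Operator

theorem linfty_opNorm_kronecker_le (C : Matrix n n ℂ) (B : Matrix m m ℂ) :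
    ‖C ⊗ₖ B‖ ≤ ‖C‖ * ‖B‖ := by
  refine linfty_opNorm_le (by positivity) fun i => ?_
  simp only [Matrix.kroneckerMap_apply, norm_mul]
  rw [Fintype.sum_prod_type' fun j k => ‖C i.1 j‖ * ‖B i.2 k‖, ← Finset.sum_mul_sum]
  gcongr
  · exact sum_norm_row_le_linfty_opNorm C i.1
  · exact sum_norm_row_le_linfty_opNorm B i.2

theorem linfty_opNorm_kroneckerSum_le [Nonempty m] [Nonempty n] (B : Matrix m m ℂ)
    (C : Matrix n n ℂ) : ‖kroneckerSum B C‖ ≤ ‖B‖ + ‖C‖ := by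
  refine (norm_add_le _ _).trans (add_le_add ?_ ?_)
  · simpa only [norm_one, one_mul] using linfty_opNorm_kronecker_le (1 : Matrix n n ℂ) B
  · simpa only [norm_one, mul_one] using linfty_opNorm_kronecker_le C (1 : Matrix m m ℂ)

end KroneckerSum

theorem symbolMean_add_pow {X Y : Type} [MeasureSpace X] [TopologicalSpace X]
    [OpensMeasurableSpace X] [T2Space X] [IsFiniteMeasureOnCompacts (volume : Measure X)]
    [SFinite (volume : Measure X)] [MeasureSpace Y] [TopologicalSpace Y] [OpensMeasurableSpace Y]
    [T2Space Y] [IsFiniteMeasureOnCompacts (volume : Measure Y)] [SFinite (volume : Measure Y)]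
    {f : X → ℂ} {g : Y → ℂ} (hf : Continuous f) (hg : Continuous g) {G : Set X} {H : Set Y}
    (hG : IsCompact G) (hH : IsCompact H) (p : ℕ) :
    symbolMean (fun θ : X × Y => f θ.1 + g θ.2) (G ×ˢ H) (fun z => z ^ p)
      = ∑ i ∈ Finset.range (p + 1), p.choose i *
          (symbolMean f G (fun z => z ^ i) * symbolMean g H (fun z => z ^ (p - i))) := by
  have hterm (i : ℕ) : IntegrableOn (fun θ : X × Y => f θ.1 ^ i * g θ.2 ^ (p - i)) (G ×ˢ H) := by
    rw [IntegrableOn, Measure.volume_eq_prod, ← Measure.prod_restrict]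
    exact ((hf.pow i).continuousOn.integrableOn_compact hG).mul_prod
      ((hg.pow (p - i)).continuousOn.integrableOn_compact hH)
  simp only [symbolMean, add_pow]
  rw [integral_finsetSum _ fun i _ => (hterm i).mul_const _, Finset.mul_sum]
  refine Finset.sum_congr rfl fun i _ => ?_
  rw [integral_mul_const, Measure.volume_eq_prod, measureReal_prod_prod,
    setIntegral_prod_mul (fun x => f x ^ i) (fun y => g y ^ (p - i))]
  push_cast
  ring

/-! ### Szegő's theorem for Kronecker sums of Toeplitz matrices -/

theorem tendsto_mul_sub_mul {u y w : ℕ → ℂ} {c : ℂ} (hu : Tendsto u atTop (𝓝 c))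
    (hyw : Tendsto (fun k => y k - w k) atTop (𝓝 0)) (hw : w =O[atTop] fun _ => (1 : ℝ)) :
    Tendsto (fun k => u k * y k - c * w k) atTop (𝓝 0) := by
  have hu_sub : (fun k => u k - c) =o[atTop] fun _ => (1 : ℝ) := by
    rw [isLittleO_one_iff, ← sub_self c]
    exact hu.sub_const c
  have hfirst := hu.mul hyw
  have hsecond := (isLittleO_one_iff ℝ).1 (by simpa only [mul_one] using hu_sub.mul_isBigO hw)
  rw [mul_zero] at hfirst
  have hsum := hfirst.add hsecond
  rw [add_zero] at hsum
  refine hsum.congr fun k => ?_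
  ring

theorem tendsto_mul_comp_of_tendsto_inf_principal {x : ℕ → ℂ} {n : ℕ → ℕ} {δ : ℕ → ℂ}
    (hx : x =O[atTop] fun _ => (1 : ℝ))
    (hxn : ∀ N, Tendsto x (atTop ⊓ 𝓟 {k | n k < N}) (𝓝 0)) (hδ : Tendsto δ atTop (𝓝 0)) :
    Tendsto (fun k => x k * δ (n k)) atTop (𝓝 0) := by
  obtain ⟨C, hC, hxC⟩ := hx.exists_pos
  obtain ⟨D, hD, hδD⟩ := (Metric.isBounded_range_of_tendsto δ hδ).exists_pos_norm_le
  rw [Metric.tendsto_nhds]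
  intro ε hε
  obtain ⟨N, hN⟩ := eventually_atTop.1 (Metric.tendsto_nhds.1 hδ (ε / C) (by positivity))
  have hsmall := eventually_inf_principal.1
    (Metric.tendsto_nhds.1 (hxn N) (ε / D) (by positivity))
  filter_upwards [hxC.bound, hsmall] with k hxk hsmall_k
  rw [norm_one, mul_one] at hxk
  simp only [dist_zero_right, norm_mul] at hN hsmall_k ⊢
  rcases lt_or_ge (n k) N with hn | hn
  · calc ‖x k‖ * ‖δ (n k)‖ ≤ ‖x k‖ * D := by
          gcongr
          exact hδD _ (mem_range_self _)
      _ < ε / D * D := by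
          gcongr
          exact hsmall_k hn
      _ = ε := div_mul_cancel₀ _ hD.ne'
  · calc ‖x k‖ * ‖δ (n k)‖ ≤ C * ‖δ (n k)‖ := by gcongr
      _ < C * (ε / C) := by
          gcongr
          exact hN _ hn
      _ = ε := mul_div_cancel₀ _ hC.ne'

section Szego

variable {a b : ℤ → ℂ} {n₁ n₂ : ℕ → ℕ} {x : ℕ → ℝ}

theorem tendsto_trace_smul_toeplitz_pow_sub (hb : Summable b) (hn₂ : ∀ k, 0 < n₂ k)
    (hx : x =O[atTop] fun _ => (1 : ℝ))
    (hxn : ∀ N, Tendsto x (atTop ⊓ 𝓟 {k | n₂ k < N}) (𝓝 0)) (p : ℕ) :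
    Tendsto (fun k => (((x k : ℂ) • toeplitz b (n₂ k)) ^ p).trace / n₂ k
      - (x k : ℂ) ^ p * convPow b p 0) atTop (𝓝 0) := by
  simp only [smul_pow, Matrix.trace_smul, smul_eq_mul, mul_div_assoc, ← mul_sub]
  rcases eq_or_ne p 0 with rfl | hp
  · refine tendsto_const_nhds.congr fun k => ?_
    have hn₂k : (n₂ k : ℂ) ≠ 0 := Nat.cast_ne_zero.2 (hn₂ k).ne'
    rw [pow_zero, pow_zero, Matrix.trace_one, Fintype.card_fin, div_self hn₂k, convPow,
      Pi.single_eq_same, sub_self, mul_zero]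
  · have hx_pow : (fun k => (x k : ℂ) ^ p) =O[atTop] fun _ => (1 : ℝ) := by
      simpa only [one_pow] using (Complex.isBigO_ofReal_left.2 hx).pow p
    have hδ := (tendsto_trace_toeplitz_pow_div hb p).sub_const (convPow b p 0)
    rw [sub_self] at hδ
    refine tendsto_mul_comp_of_tendsto_inf_principal hx_pow (fun N => ?_) hδ
    have hlim := ((Complex.continuous_ofReal.tendsto 0).comp (hxn N)).pow p
    rwa [Complex.ofReal_zero, zero_pow hp] at hlim

theorem tendsto_trace_kroneckerSum_toeplitz_pow_sub (ha : Summable a) (hb : Summable b)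
    (hn₁ : Tendsto n₁ atTop atTop) (hn₂ : ∀ k, 0 < n₂ k) (hx : x =O[atTop] fun _ => (1 : ℝ))
    (hxn : ∀ N, Tendsto x (atTop ⊓ 𝓟 {k | n₂ k < N}) (𝓝 0)) (p : ℕ) :
    Tendsto (fun k =>
      (kroneckerSum (toeplitz a (n₁ k)) ((x k : ℂ) • toeplitz b (n₂ k)) ^ p).trace
          / (n₂ k * n₁ k : ℕ)
        - ∑ i ∈ Finset.range (p + 1), p.choose i *
            (convPow a i 0 * ((x k : ℂ) ^ (p - i) * convPow b (p - i) 0))) atTop (𝓝 0) := by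
  have hbounded (i : ℕ) : (fun k => (x k : ℂ) ^ i * convPow b i 0) =O[atTop] fun _ => (1 : ℝ) := by
    simpa only [one_pow, mul_one] using ((Complex.isBigO_ofReal_left.2 hx).pow i).mul
      (isBigO_const_const (convPow b i 0) one_ne_zero atTop)
  have hterm (i : ℕ) := (tendsto_mul_sub_mul ((tendsto_trace_toeplitz_pow_div ha i).comp hn₁)
    (tendsto_trace_smul_toeplitz_pow_sub hb hn₂ hx hxn (p - i))
    (hbounded (p - i))).const_mul (p.choose i : ℂ)
  simp only [mul_zero] at hterm
  have hsum := tendsto_finsetSum (Finset.range (p + 1)) fun i _ => hterm i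
  rw [Finset.sum_const_zero] at hsum
  refine hsum.congr fun k => ?_
  rw [trace_kroneckerSum_pow, Finset.sum_div, ← Finset.sum_sub_distrib]
  refine Finset.sum_congr rfl fun i _ => ?_
  rw [mul_sub, mul_div_assoc, Nat.cast_mul, mul_comm (n₂ k : ℂ), mul_div_mul_comm,
    Function.comp_apply]

theorem symbolMean_trigSum_add_mul_trigSum_pow (ha : Summable a) (hb : Summable b) (c : ℂ)
    (p : ℕ) :
    symbolMean (fun θ : ℝ × ℝ => trigSum a θ.1 + c * trigSum b θ.2)
        (Icc (-Real.pi) Real.pi ×ˢ Icc (-Real.pi) Real.pi) (fun z => z ^ p)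
      = ∑ i ∈ Finset.range (p + 1), p.choose i *
          (convPow a i 0 * (c ^ (p - i) * convPow b (p - i) 0)) := by
  have hcb : Continuous fun ξ => c * trigSum b ξ := (continuous_trigSum hb).const_mul c
  rw [symbolMean_add_pow (continuous_trigSum ha) hcb isCompact_Icc isCompact_Icc]
  refine Finset.sum_congr rfl fun i _ => ?_
  rw [symbolMean_trigSum_pow ha, ← symbolMean_trigSum_pow hb]
  simp only [symbolMean, mul_pow, integral_const_mul]
  ring

open scoped Matrix.Norms.Operator

/-- The factor `x k` may fail to tend to `0` only as `n₂ k → ∞`: where `n₂ k` stays bounded, the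
Toeplitz matrices of `b` are not yet distributed as their symbol and have to drop out. -/
theorem eigDistributedVarying_kroneckerSum_toeplitz (ha : Summable a) (hb : Summable b)
    (ha_neg : ∀ k, a (-k) = starRingEnd ℂ (a k)) (hb_neg : ∀ k, b (-k) = starRingEnd ℂ (b k))
    (hn₁ : Tendsto n₁ atTop atTop) (hn₂ : ∀ k, 0 < n₂ k) (hx : x =O[atTop] fun _ => (1 : ℝ))
    (hxn : ∀ N, Tendsto x (atTop ⊓ 𝓟 {k | n₂ k < N}) (𝓝 0)) :
    EigDistributedVarying
      (fun k => kroneckerSum (toeplitz a (n₁ k)) ((x k : ℂ) • toeplitz b (n₂ k)))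
      (fun k θ => trigSum a θ.1 + x k * trigSum b θ.2)
      (Icc (-Real.pi) Real.pi ×ˢ Icc (-Real.pi) Real.pi) := by
  have hA (k : ℕ) :
      (kroneckerSum (toeplitz a (n₁ k)) ((x k : ℂ) • toeplitz b (n₂ k))).IsHermitian :=
    isHermitian_kroneckerSum (isHermitian_toeplitz ha_neg _)
      ((isHermitian_toeplitz hb_neg _).smul (Complex.conj_ofReal _))
  have ha_cont := continuous_trigSum ha
  have hb_cont := continuous_trigSum hb
  obtain ⟨C, hC, hxC⟩ := hx.exists_pos
  refine eigDistributedVarying_of_tendsto_moments (K := ∑' k, ‖a k‖ + C * ∑' k, ‖b k‖)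
    (fun k => by fun_prop) (isCompact_Icc.prod isCompact_Icc) ?_ ?_ fun p => ?_
  · filter_upwards [hn₁.eventually_gt_atTop 0, hxC.bound] with k hn₁k hxk
    rw [norm_one, mul_one, ← Complex.norm_real] at hxk
    have : Nonempty (Fin (n₁ k)) := Fin.pos_iff_nonempty.1 hn₁k
    have : Nonempty (Fin (n₂ k)) := Fin.pos_iff_nonempty.1 (hn₂ k)
    refine roots_charpoly_mem_Icc (hA k) ((linfty_opNorm_kroneckerSum_le _ _).trans ?_)
    rw [norm_smul]
    gcongr
    · exact linfty_opNorm_toeplitz_le ha _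
    · exact linfty_opNorm_toeplitz_le hb _
  · filter_upwards [hxC.bound] with k hxk θ _
    rw [norm_one, mul_one, ← Complex.norm_real] at hxk
    have him : (trigSum a θ.1 + x k * trigSum b θ.2).im = 0 := by
      rw [Complex.add_im, Complex.im_ofReal_mul, im_trigSum_eq_zero ha_neg,
        im_trigSum_eq_zero hb_neg, mul_zero, add_zero]
    have hnorm : ‖trigSum a θ.1 + x k * trigSum b θ.2‖ ≤ ∑' k, ‖a k‖ + C * ∑' k, ‖b k‖ := by
      refine (norm_add_le _ _).trans ?_
      rw [norm_mul]
      gcongr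
      · exact norm_trigSum_le ha _
      · exact norm_trigSum_le hb _
    exact ⟨_, abs_le.1 ((Complex.abs_re_le_norm _).trans hnorm),
      Complex.ext (Complex.ofReal_re _) ((Complex.ofReal_im _).trans him.symm)⟩
  · have hmoments := tendsto_trace_kroneckerSum_toeplitz_pow_sub ha hb hn₁ hn₂ hx hxn p
    simpa only [eigMean_pow_eq_trace_div (hA _), symbolMean_trigSum_add_mul_trigSum_pow ha hb,
      Fintype.card_prod, Fintype.card_fin] using hmoments

end Szego

/-! ### The Crank–Nicolson coefficient matrices -/

theorem add_succ_mul_div_mem_Ioo {a b : ℝ} (hab : a < b) {n : ℕ} (i : Fin n) :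
    a + ((i : ℕ) + 1) * ((b - a) / (n + 1)) ∈ Ioo a b := by
  have hlength : 0 < b - a := sub_pos.2 hab
  have hi : ((i : ℕ) : ℝ) + 1 < n + 1 := by
    gcongr
    exact i.2
  have hlt : ((i : ℕ) + 1) * ((b - a) / (n + 1)) < b - a := by
    rw [← mul_div_assoc, div_lt_iff₀ (by positivity), mul_comm]
    exact mul_lt_mul_of_pos_left hi hlength
  exact ⟨lt_add_of_pos_right a (by positivity), by linarith⟩

theorem toepA_add_transpose_apply (γ : ℝ) {n : ℕ} (i j : Fin n) :
    toepA γ n i j + toepA γ n j i = qCoeff γ ((i : ℤ) - j) := by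
  rw [toepA_apply_eq_fCoeff, toepA_apply_eq_fCoeff, qCoeff, neg_sub]

section SymbolF

variable {α β : ℝ}

theorem symbolF_eq_trigSum (hα : α ∈ Icc (1 : ℝ) 2) (hβ : β ∈ Icc (1 : ℝ) 2) (d e c : ℝ) :
    symbolF α β d e c = fun θ =>
      trigSum (fun k => d * qCoeff α k) θ.1 + c * trigSum (fun k => e * qCoeff β k) θ.2 := by
  funext θ
  rw [symbolF, qSymbol_eq_trigSum hα, qSymbol_eq_trigSum hβ, trigSum_const_mul, trigSum_const_mul]
  ring

theorem continuous_symbolF (hα : α ∈ Icc (1 : ℝ) 2) (hβ : β ∈ Icc (1 : ℝ) 2) (d e c : ℝ) :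
    Continuous (symbolF α β d e c) := by
  have hqα := continuous_qSymbol hα
  have hqβ := continuous_qSymbol hβ
  unfold symbolF
  fun_prop

theorem im_symbolF (α β d e c : ℝ) (θ : ℝ × ℝ) : (symbolF α β d e c θ).im = 0 := by
  rw [symbolF, ← Complex.ofReal_mul, Complex.add_im, Complex.im_ofReal_mul, Complex.im_ofReal_mul,
    im_qSymbol, im_qSymbol, mul_zero, mul_zero, add_zero]

theorem re_symbolF_nonneg (hα : α ∈ Icc (1 : ℝ) 2) (hβ : β ∈ Icc (1 : ℝ) 2) {d e c : ℝ}
    (hd : 0 ≤ d) (he : 0 ≤ e) (hc : 0 ≤ c) (θ : ℝ × ℝ) : 0 ≤ (symbolF α β d e c θ).re := by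
  have hqα := re_qSymbol_nonneg hα θ.1
  have hqβ := re_qSymbol_nonneg hβ θ.2
  rw [symbolF, ← Complex.ofReal_mul, Complex.add_re, Complex.re_ofReal_mul, Complex.re_ofReal_mul]
  positivity

end SymbolF

namespace FDEData

variable (P : FDEData)

theorem hx_pos (n : ℕ) : 0 < P.hx n := div_pos (sub_pos.2 P.hab₁) (by positivity)

theorem hy_pos (n : ℕ) : 0 < P.hy n := div_pos (sub_pos.2 P.hab₂) (by positivity)

theorem hx_antitone : Antitone P.hx := fun _ _ h =>
  div_le_div_of_nonneg_left (sub_pos.2 P.hab₁).le (by positivity) (by gcongr)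

theorem hy_antitone : Antitone P.hy := fun _ _ h =>
  div_le_div_of_nonneg_left (sub_pos.2 P.hab₂).le (by positivity) (by gcongr)

theorem one_div_r (n M : ℕ) : 1 / P.r n M = 2 / P.T * (M * P.hx n ^ P.α) := by
  rw [r, dt, one_div_div, div_div_eq_mul_div, div_eq_mul_inv, div_eq_mul_inv]
  ring

theorem s_div_r (n₁ n₂ : ℕ) {M : ℕ} (hM : 0 < M) :
    P.s n₂ M / P.r n₁ M = P.hx n₁ ^ P.α / P.hy n₂ ^ P.β := by
  have hdt : P.dt M ≠ 0 := (div_pos P.hT (Nat.cast_pos.2 hM)).ne'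
  rw [s, r, div_div_div_cancel_left' _ _ hdt, mul_div_mul_left _ _ two_ne_zero]

theorem natCast_mul_dt_mem_Ioc {M m : ℕ} (hm : 1 ≤ m ∧ m ≤ M) : m * P.dt M ∈ Ioc 0 P.T := by
  have hT := P.hT
  have hm_pos : (0 : ℝ) < m := Nat.cast_pos.2 hm.1
  have hmM : (m : ℝ) ≤ M := Nat.cast_le.2 hm.2
  have hM_pos : (0 : ℝ) < M := hm_pos.trans_le hmM
  rw [dt]
  refine ⟨by positivity, ?_⟩
  rw [← mul_div_assoc, div_le_iff₀ hM_pos, mul_comm]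
  gcongr

theorem diagSample_eq_smul_one {c : ℝ → ℝ → ℝ → ℝ} {c₀ : ℝ}
    (hc : ∀ x ∈ Ioo P.a₁ P.b₁, ∀ y ∈ Ioo P.a₂ P.b₂, ∀ t ∈ Ioc 0 P.T, c x y t = c₀)
    (n₁ n₂ : ℕ) {M m : ℕ} (hm : 1 ≤ m ∧ m ≤ M) : P.diagSample c n₁ n₂ M m = c₀ • 1 := by
  rw [Matrix.smul_one_eq_diagonal, diagSample]
  congr 1
  funext p
  exact hc _ (add_succ_mul_div_mem_Ioo P.hab₁ p.2) _ (add_succ_mul_div_mem_Ioo P.hab₂ p.1) _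
    (P.natCast_mul_dt_mem_Ioc hm)

theorem map_coeffMatrix_eq_kroneckerSum {d e : ℝ}
    (hcoeff : ∀ x ∈ Ioo P.a₁ P.b₁, ∀ y ∈ Ioo P.a₂ P.b₂, ∀ t ∈ Ioc 0 P.T,
      P.dPlus x y t = d ∧ P.dMinus x y t = d ∧ P.ePlus x y t = e ∧ P.eMinus x y t = e)
    (n₁ n₂ : ℕ) {M m : ℕ} (hm : 1 ≤ m ∧ m ≤ M) :
    (P.coeffMatrix n₁ n₂ M m).map (fun a : ℝ => (a : ℂ))
      = kroneckerSum (toeplitz (fun k => d * qCoeff P.α k) n₁)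
          (((P.s n₂ M / P.r n₁ M : ℝ) : ℂ) • toeplitz (fun k => e * qCoeff P.β k) n₂)
        + ((1 / P.r n₁ M : ℝ) : ℂ) • 1 := by
  have hdPlus :=
    P.diagSample_eq_smul_one (fun x hx y hy t ht => (hcoeff x hx y hy t ht).1) n₁ n₂ hm
  have hdMinus :=
    P.diagSample_eq_smul_one (fun x hx y hy t ht => (hcoeff x hx y hy t ht).2.1) n₁ n₂ hm
  have hePlus :=
    P.diagSample_eq_smul_one (fun x hx y hy t ht => (hcoeff x hx y hy t ht).2.2.1) n₁ n₂ hm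
  have heMinus :=
    P.diagSample_eq_smul_one (fun x hx y hy t ht => (hcoeff x hx y hy t ht).2.2.2) n₁ n₂ hm
  ext p q
  simp only [coeffMatrix, matAx, matAy, hdPlus, hdMinus, hePlus, heMinus, kroneckerSum, toeplitz,
    Matrix.map_apply, Matrix.add_apply, Matrix.smul_apply, Matrix.smul_mul, one_mul,
    Matrix.kroneckerMap_apply, Matrix.transpose_apply, Matrix.of_apply, smul_eq_mul,
    ← toepA_add_transpose_apply, Matrix.one_apply]
  push_cast [apply_ite Complex.ofReal]
  ring

section Mesh

variable {n₁ n₂ M : ℕ → ℕ}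

theorem tendsto_hx_rpow (hM : ∀ k, 0 < M k)
    (hr : Tendsto (fun k => 1 / P.r (n₁ k) (M k)) atTop (𝓝 0)) :
    Tendsto (fun k => P.hx (n₁ k) ^ P.α) atTop (𝓝 0) := by
  have hMhx := hr.const_mul (P.T / 2)
  rw [mul_zero] at hMhx
  have hpos (k : ℕ) : 0 ≤ P.hx (n₁ k) ^ P.α := Real.rpow_nonneg (P.hx_pos _).le _
  refine squeeze_zero hpos (fun k => ?_) hMhx
  rw [one_div_r, ← mul_assoc, div_mul_div_cancel₀' P.hT.ne', div_self two_ne_zero, one_mul]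
  exact le_mul_of_one_le_left (hpos k) (Nat.one_le_cast.2 (hM k))

theorem tendsto_atTop_of_tendsto_hx_rpow
    (hhx : Tendsto (fun k => P.hx (n₁ k) ^ P.α) atTop (𝓝 0)) : Tendsto n₁ atTop atTop := by
  refine tendsto_atTop.2 fun N => ?_
  filter_upwards [hhx.eventually_lt_const (Real.rpow_pos_of_pos (P.hx_pos N) P.α)] with k hk
  rw [Real.rpow_lt_rpow_iff (P.hx_pos _).le (P.hx_pos _).le (zero_lt_one.trans P.hα.1)] at hk
  exact (P.hx_antitone.reflect_lt hk).le

theorem tendsto_s_div_r_inf_principal (hM : ∀ k, 0 < M k)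
    (hhx : Tendsto (fun k => P.hx (n₁ k) ^ P.α) atTop (𝓝 0)) (N : ℕ) :
    Tendsto (fun k => P.s (n₂ k) (M k) / P.r (n₁ k) (M k)) (atTop ⊓ 𝓟 {k | n₂ k < N}) (𝓝 0) := by
  have hbound := (hhx.div_const (P.hy N ^ P.β)).mono_left
    (inf_le_left : atTop ⊓ 𝓟 {k | n₂ k < N} ≤ atTop)
  rw [zero_div] at hbound
  have hx_nonneg (k : ℕ) := Real.rpow_nonneg (P.hx_pos (n₁ k)).le P.α
  have hy_rpow_pos (n : ℕ) := Real.rpow_pos_of_pos (P.hy_pos n) P.β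
  simp only [P.s_div_r _ _ (hM _)]
  refine squeeze_zero' (.of_forall fun k => div_nonneg (hx_nonneg k) (hy_rpow_pos _).le)
    (eventually_inf_principal.2 (.of_forall fun k hk => ?_)) hbound
  exact div_le_div_of_nonneg_left (hx_nonneg k) (hy_rpow_pos N)
    (Real.rpow_le_rpow (P.hy_pos N).le (P.hy_antitone (le_of_lt hk))
      (zero_le_one.trans P.hβ.1.le))

end Mesh

theorem eigDistributedVarying_coeffMatrix {d e : ℝ}
    (hcoeff : ∀ x ∈ Ioo P.a₁ P.b₁, ∀ y ∈ Ioo P.a₂ P.b₂, ∀ t ∈ Ioc 0 P.T,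
      P.dPlus x y t = d ∧ P.dMinus x y t = d ∧ P.ePlus x y t = e ∧ P.eMinus x y t = e)
    {n₁ n₂ M m : ℕ → ℕ} (hn₂ : ∀ k, 0 < n₂ k) (hm : ∀ k, 1 ≤ m k ∧ m k ≤ M k)
    (hr : Tendsto (fun k => 1 / P.r (n₁ k) (M k)) atTop (𝓝 0))
    (hsr : (fun k => P.s (n₂ k) (M k) / P.r (n₁ k) (M k)) =O[atTop] (fun _ => (1 : ℝ))) :
    EigDistributedVarying
      (fun k => (P.coeffMatrix (n₁ k) (n₂ k) (M k) (m k)).map (fun a : ℝ => (a : ℂ)))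
      (fun k => symbolF P.α P.β d e (P.s (n₂ k) (M k) / P.r (n₁ k) (M k)))
      (Icc (-Real.pi) Real.pi ×ˢ Icc (-Real.pi) Real.pi) := by
  have hα := Ioo_subset_Icc_self P.hα
  have hβ := Ioo_subset_Icc_self P.hβ
  have hM (k : ℕ) : 0 < M k := (hm k).1.trans (hm k).2
  have hhx := P.tendsto_hx_rpow hM hr
  have hKronecker := eigDistributedVarying_kroneckerSum_toeplitz
    ((summable_ofReal_qCoeff hα).mul_left (d : ℂ)) ((summable_ofReal_qCoeff hβ).mul_left (e : ℂ))
    (ofReal_mul_qCoeff_neg d P.α) (ofReal_mul_qCoeff_neg e P.β)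
    (P.tendsto_atTop_of_tendsto_hx_rpow hhx) hn₂ hsr (P.tendsto_s_div_r_inf_principal hM hhx)
  have hshift := hKronecker.add_smul_one ((Complex.continuous_ofReal.tendsto 0).comp hr)
  simpa only [P.map_coeffMatrix_eq_kroneckerSum hcoeff _ _ (hm _), symbolF_eq_trigSum hα hβ,
    Function.comp_apply] using hshift

end FDEData

theorem proposition3 (P : FDEData) (d e : ℝ) (hd : 0 < d) (he : 0 < e)
    (hcoeff : ∀ x ∈ Ioo P.a₁ P.b₁, ∀ y ∈ Ioo P.a₂ P.b₂, ∀ t ∈ Ioc 0 P.T,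
      P.dPlus x y t = d ∧ P.dMinus x y t = d ∧ P.ePlus x y t = e ∧ P.eMinus x y t = e)
    (n₁ n₂ M m : ℕ → ℕ)
    (hn₁ : ∀ k, 0 < n₁ k) (hn₂ : ∀ k, 0 < n₂ k) (hm : ∀ k, 1 ≤ m k ∧ m k ≤ M k)
    (hN : Tendsto (fun k => n₁ k * n₂ k) atTop atTop)
    (hr : (fun k => 1 / P.r (n₁ k) (M k)) =o[atTop] (fun _ => (1 : ℝ)))
    (hsr : (fun k => P.s (n₂ k) (M k) / P.r (n₁ k) (M k)) =O[atTop] (fun _ => (1 : ℝ))) :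
    -- the series defining the symbols converge absolutely, and `f_γ(-ξ)` is conjugate to `f_γ(ξ)`
    (Summable (fun k => |wCoeff P.α k|) ∧ Summable (fun k => |wCoeff P.β k|)) ∧
    (∀ ξ : ℝ, fSymbol P.α (-ξ) = (starRingEnd ℂ) (fSymbol P.α ξ) ∧
      fSymbol P.β (-ξ) = (starRingEnd ℂ) (fSymbol P.β ξ)) ∧
    -- the symbol is continuous, real-valued and nonnegative, for every value `c ≥ 0` of the ratio
    (∀ c : ℝ, 0 ≤ c → Continuous (symbolF P.α P.β d e c) ∧
      ∀ θ : ℝ × ℝ, (symbolF P.α P.β d e c θ).im = 0 ∧ 0 ≤ (symbolF P.α P.β d e c θ).re) ∧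
    -- eigenvalue distribution with the ratio `s / r` of each discretization in the symbol
    EigDistributedVarying
      (fun k => (P.coeffMatrix (n₁ k) (n₂ k) (M k) (m k)).map (fun a : ℝ => (a : ℂ)))
      (fun k => symbolF P.α P.β d e (P.s (n₂ k) (M k) / P.r (n₁ k) (M k)))
      (Icc (-Real.pi) Real.pi ×ˢ Icc (-Real.pi) Real.pi) ∧
    -- eigenvalue distribution with a fixed symbol whenever `s / r` has a limit
    (∀ c : ℝ, Tendsto (fun k => P.s (n₂ k) (M k) / P.r (n₁ k) (M k)) atTop (𝓝 c) →
      EigDistributed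
        (fun k => (P.coeffMatrix (n₁ k) (n₂ k) (M k) (m k)).map (fun a : ℝ => (a : ℂ)))
        (symbolF P.α P.β d e c)
        (Icc (-Real.pi) Real.pi ×ˢ Icc (-Real.pi) Real.pi)) := by
  have hα := Ioo_subset_Icc_self P.hα
  have hβ := Ioo_subset_Icc_self P.hβ
  have hdistributed := P.eigDistributedVarying_coeffMatrix hcoeff hn₂ hm
    ((isLittleO_one_iff ℝ).1 hr) hsr
  refine ⟨⟨(hasSum_wCoeff hα).summable.abs, (hasSum_wCoeff hβ).summable.abs⟩,
    fun ξ => ⟨fSymbol_neg _ ξ, fSymbol_neg _ ξ⟩,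
    fun c hc => ⟨continuous_symbolF hα hβ d e c,
      fun θ => ⟨im_symbolF _ _ _ _ _ θ, re_symbolF_nonneg hα hβ hd.le he.le hc θ⟩⟩,
    hdistributed, fun c hc => ?_⟩
  refine hdistributed.eigDistributed (fun _ => continuous_symbolF hα hβ d e _)
    (isCompact_Icc.prod isCompact_Icc) fun θ => ?_
  have hc_ofReal := (Complex.continuous_ofReal.tendsto c).comp hc
  exact ((hc_ofReal.const_mul (e : ℂ)).mul_const _).const_add _
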